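/- **Conventions.** All maps are $C^\infty$. For a nondegenerate hypersurface immersion $f\colon M^n\to\mathbb R^{n+1}$ with affine (Blaschke) normal $\xi$ (transversal, $D\xi$ tangential, $|\det(f_*X_1,\dots,f_*X_n,\xi)|=|\det h(X_i,X_j)|^{1/2}$; unique up to sign) let $h$, $\nabla$, $S$ be given by $D_XY=\nabla_XY+h(X,Y)\xi$, $D_X\xi=-SX$, and let $K=\nabla-\hat\nabla$, where $\hat\nabla$ is the Levi-Civita connection of $h$. The immersion is an affine hypersphere of mean curvature $H$ if $S=H\,\mathrm{Id}$ with $H$ constant; it is called improper if $H=0$, and proper of normalized mean curvature if $H=\pm1$. A three-dimensional affine hypersphere is called indefinite if $h$ is; then $\xi$ is oriented so that $h$ has exactly one negative direction. An orthonormal basis of $T_pM$ is a basis $(\mathbf t,\mathbf v,\mathbf w)$ with $h(\mathbf t,\mathbf t)=-1$, $h(\mathbf v,\mathbf v)=h(\mathbf w,\mathbf w)=1$ and all other products zero; with respect to it let $A_s$ be the linear map that fixes $\mathbf t$ and rotates the $(\mathbf v,\mathbf w)$-plane by the angle $s$, and put $SO(2)=\{A_s: s\in\mathbb R\}$ and $\mathbb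 Z_3=\langle A_{2\pi/3}\rangle$. For $G\in\{\mathbb Z_3,SO(2)\}$ the hypersurface admits a pointwise $G$-symmetry if every $T_pM$ has an orthonormal basis with respect to which all elements of $G$ preserve $h$, $K$ and $S$ at $p$. **Theorem.** Let $N^2$ be a smooth surface and let $\phi\colon N^2\to\mathbb R^3$ be a positive definite elliptic ($\varepsilon_1=1$) or hyperbolic ($\varepsilon_1=-1$) affine sphere with mean curvature $\varepsilon_1$ centred at the origin, i.e. with affine normal $-\varepsilon_1\phi$ and positive definite affine metric. Let $\gamma=(\gamma_1,\gamma_2)\colon I\to\mathbb R^2$ be a smooth curve on an open interval $I$, and put $$\varphi\colon I\times N^2\to\mathbb R^4,\qquad \varphi(t,q)=(\gamma_1(t),\gamma_2(t)\,\phi(q)).$$ 1. If $\varphi$ is a three-dimensional indefinite affine hypersphere, then $\varphi$ admits a pointwise $\mathbb Z_3$- or $SO(2)$-symmetry. More precisely, at each point $p$ there is an orthonormal basis $(\mathbf t,\mathbf v,\mathbf w)$ such that the group of those $A_s$ that preserve $K$ at $p$ is exactly $\mathbb Z_3$ or exactly $SO(2)$; and if $K(\mathbf t,\mathbf t)\neq0$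 at $p$, then this group is the whole stabilizer of $K$ at $p$ in $SO(1,2)$. 2. If on all of $I$ $$\gamma_2^2\,|\gamma_1\gamma_2'-\gamma_1'\gamma_2|^5=\operatorname{sign}(\gamma_1'\gamma_2\varepsilon_1)\,(\gamma_1'\gamma_2''-\gamma_1''\gamma_2')\,(\gamma_1')^2\neq0,$$ then $\varphi$ is a three-dimensional indefinite proper affine hypersphere (with $H=\pm1$). 3. If on all of $I$ $$\gamma_2^2\,|\gamma_2'|^5=\operatorname{sign}(\gamma_1'\gamma_2\varepsilon_1)\,(\gamma_1'\gamma_2''-\gamma_1''\gamma_2')\,(\gamma_1')^2\neq0,$$ then $\varphi$ is a three-dimensional indefinite improper affine hypersphere. -/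

import Mathlib

open scoped Manifold ContDiff

noncomputable section

namespace AffineGeom

/-! ### Equi-affine hypersurface theory in a coordinate domain

`f` is a map from a (coordinate domain in a) vector space `E` to `ℝⁿ⁺¹` and `ξ` is a vector field
along `f`. Tangent vectors are elements of `E`, and they also stand for constant vector fields. -/

section Coordinates

variable {E : Type*} [NormedAddCommGroup E] [NormedSpace ℝ E] {n : ℕ}

/-- The map `(X, c) ↦ f_* X + c ξ` from `E × ℝ` to `ℝⁿ⁺¹` at the point `y`. -/
def frame (f ξ : E → Fin (n + 1) → ℝ) (y : E) : E × ℝ →L[ℝ] (Fin (n + 1) → ℝ) :=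
  (fderiv ℝ f y).coprod (ContinuousLinearMap.toSpanSingleton ℝ (ξ y))

/-- The decomposition `v = f_* X + c ξ ↦ (X, c)` of vectors of `ℝⁿ⁺¹` into the tangential and the
transversal component (the inverse of `frame`, which is meaningful if `frame` is bijective). -/
def split (f ξ : E → Fin (n + 1) → ℝ) (y : E) : (Fin (n + 1) → ℝ) →L[ℝ] E × ℝ :=
  (frame f ξ y).inverse

/-- The affine metric `h`, the transversal part in the Gauss formula
`D_X D_Y f = f_* (∇_X Y) + h(X,Y) ξ`. -/
def metric (f ξ : E → Fin (n + 1) → ℝ) (y : E) : E →L[ℝ] E →L[ℝ] ℝ :=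
  (ContinuousLinearMap.compL ℝ E (Fin (n + 1) → ℝ) ℝ
    ((ContinuousLinearMap.snd ℝ E ℝ).comp (split f ξ y))).comp (fderiv ℝ (fderiv ℝ f) y)

/-- The Christoffel form `∇_X Y` (for constant `X`, `Y`) of the induced connection, the tangential
part in the Gauss formula. -/
def inducedConnection (f ξ : E → Fin (n + 1) → ℝ) (y X Y : E) : E :=
  (split f ξ y (fderiv ℝ (fderiv ℝ f) y X Y)).1

/-- The affine shape operator `S`, from the Weingarten formula `D_X ξ = - f_* (S X) + τ(X) ξ`. -/
def shape (f ξ : E → Fin (n + 1) → ℝ) (y X : E) : E :=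
  -(split f ξ y (fderiv ℝ ξ y X)).1

/-- The transversal connection form `τ` in the formula `D_X ξ = - f_* (S X) + τ(X) ξ`. -/
def transversalForm (f ξ : E → Fin (n + 1) → ℝ) (y X : E) : ℝ :=
  (split f ξ y (fderiv ℝ ξ y X)).2

/-- The one-form `Z ↦ ½ (X h(Y,Z) + Y h(X,Z) - Z h(X,Y))` for constant `X`, `Y`. -/
def koszulForm (g : E → E →L[ℝ] E →L[ℝ] ℝ) (y X Y : E) : E →L[ℝ] ℝ :=
  (1 / 2 : ℝ) • (fderiv ℝ g y X Y + fderiv ℝ g y Y X - ((fderiv ℝ g y).flip X).flip Y)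

/-- The Christoffel form of the Levi-Civita connection of a nondegenerate metric `g`: the vector
`W` with `g(W, Z) = ½ (X g(Y,Z) + Y g(X,Z) - Z g(X,Y))` for all `Z`. -/
def leviCivita (g : E → E →L[ℝ] E →L[ℝ] ℝ) (y X Y : E) : E :=
  (g y).inverse (koszulForm g y X Y)

/-- The difference tensor `K(X,Y) = ∇_X Y - ∇̂_X Y`. -/
def differenceTensor (f ξ : E → Fin (n + 1) → ℝ) (y X Y : E) : E :=
  inducedConnection f ξ y X Y - leviCivita (metric f ξ) y X Y

/-- At `y`, the map `f` is a nondegenerate immersion and `ξ` satisfies the conditions that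
characterize the affine (Blaschke) normal up to sign. -/
structure IsBlaschkeNormalAt (f ξ : E → Fin (n + 1) → ℝ) (y : E) : Prop where
  /-- `f` is an immersion and `ξ` is transversal: `ℝⁿ⁺¹ = f_* E ⊕ ℝ ξ`. -/
  transversal : Function.Bijective (frame f ξ y)
  /-- The affine metric is nondegenerate. -/
  nondegenerate : ∀ X : E, (∀ Y : E, metric f ξ y X Y = 0) → X = 0
  /-- `D ξ` is tangential. -/
  tangential : ∀ X : E, transversalForm f ξ y X = 0
  /-- The induced volume `|det (f_* X₁, …, f_* Xₙ, ξ)|` is the volume `|det h(Xᵢ, Xⱼ)|^(1/2)`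
  of the affine metric. -/
  volume_eq : ∀ X : Fin n → E,
    |Matrix.det (Matrix.of (Fin.snoc (α := fun _ => Fin (n + 1) → ℝ)
      (fun i => fderiv ℝ f y (X i)) (ξ y)))|
      = Real.sqrt |Matrix.det (Matrix.of fun i j => metric f ξ y (X i) (X j))|

end Coordinates

/-! ### Hypersurfaces parametrized by a manifold

`M` is a manifold without boundary modelled on `E`. As everywhere in Mathlib, the tangent space at
`p` is identified with `E` by the preferred chart at `p`; the tensors at `p` are computed in this
chart. -/

section Manifold

variable {E : Type*} [NormedAddCommGroup E] [NormedSpace ℝ E] {H : Type*} [TopologicalSpace H]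
  (I : ModelWithCorners ℝ E H) [I.Boundaryless]
  {M : Type*} [TopologicalSpace M] [ChartedSpace H M] {n : ℕ}

/-- The map `f`, written in the preferred chart at `p`. -/
def inChart (f : M → Fin (n + 1) → ℝ) (p : M) : E → Fin (n + 1) → ℝ :=
  f ∘ (extChartAt I p).symm

/-- The affine metric `h` at `p`, a bilinear form on `T_p M`. -/
def metricAt (f ξ : M → Fin (n + 1) → ℝ) (p : M) : E →L[ℝ] E →L[ℝ] ℝ :=
  metric (inChart I f p) (inChart I ξ p) (extChartAt I p p)

/-- The difference tensor `K` at `p`. -/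
def differenceTensorAt (f ξ : M → Fin (n + 1) → ℝ) (p : M) (X Y : E) : E :=
  differenceTensor (inChart I f p) (inChart I ξ p) (extChartAt I p p) X Y

/-- The affine shape operator `S` at `p`. -/
def shapeAt (f ξ : M → Fin (n + 1) → ℝ) (p : M) (X : E) : E :=
  shape (inChart I f p) (inChart I ξ p) (extChartAt I p p) X

/-- On the open set `U`, the map `f` is a smooth nondegenerate hypersurface immersion into `ℝⁿ⁺¹`
and `ξ` is its affine (Blaschke) normal (which is unique up to sign). The conditions are required
in all preferred charts, at all points of their domains that lie in `U`. -/
structure IsBlaschkeImmersionOn (f ξ : M → Fin (n + 1) → ℝ) (U : Set M) : Prop where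
  smooth : ContMDiffOn I 𝓘(ℝ, Fin (n + 1) → ℝ) ∞ f U
  smooth_normal : ContMDiffOn I 𝓘(ℝ, Fin (n + 1) → ℝ) ∞ ξ U
  blaschke : ∀ p : M, ∀ y ∈ (extChartAt I p).target, (extChartAt I p).symm y ∈ U →
    IsBlaschkeNormalAt (inChart I f p) (inChart I ξ p) y

/-- `f` is an affine hypersphere on `U` with affine normal `ξ` and affine mean curvature `c`:
the affine shape operator is `S = c Id` with a constant `c`. -/
structure IsAffineHypersphereOn (f ξ : M → Fin (n + 1) → ℝ) (c : ℝ) (U : Set M) : Prop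
    extends IsBlaschkeImmersionOn I f ξ U where
  shape_eq : ∀ p : M, ∀ y ∈ (extChartAt I p).target, (extChartAt I p).symm y ∈ U →
    ∀ X : E, shape (inChart I f p) (inChart I ξ p) y X = c • X

/-- `b = (t, v, w)` is an orthonormal basis of a three-dimensional Lorentz space:
`h(t,t) = -1`, `h(v,v) = h(w,w) = 1`, and the other products vanish. -/
def IsLorentzONB (h : E →L[ℝ] E →L[ℝ] ℝ) (b : Module.Basis (Fin 3) ℝ E) : Prop :=
  ∀ i j, h (b i) (b j) = Matrix.diagonal ![(-1 : ℝ), 1, 1] i j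

/-- `f` is a three-dimensional indefinite affine hypersphere on `U` with affine mean curvature `c`
and with affine normal `ξ`, which is oriented such that the affine metric has exactly one negative
direction. -/
structure IsIndefiniteAffineHypersphereOn (f ξ : M → Fin 4 → ℝ) (c : ℝ) (U : Set M) : Prop
    extends IsAffineHypersphereOn I f ξ c U where
  lorentz : ∀ p ∈ U, ∃ b : Module.Basis (Fin 3) ℝ E, IsLorentzONB (metricAt I f ξ p) b

/-- The set of those endomorphisms of determinant one of `T_p M`, written as matrices with
respect to the basis `b`, that preserve `h`, `K` and `S` at `p`. If `b` is a Lorentz orthonormal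
basis, then this is the stabilizer in `SO(1,2)` of the difference tensor and the shape operator. -/
def symmetriesAt (f ξ : M → Fin 4 → ℝ) (p : M) (b : Module.Basis (Fin 3) ℝ E) :
    Set (Matrix.SpecialLinearGroup (Fin 3) ℝ) :=
  {A | let L : E →ₗ[ℝ] E := Matrix.toLin b b A.1
    (∀ X Y, metricAt I f ξ p (L X) (L Y) = metricAt I f ξ p X Y) ∧
    (∀ X Y, differenceTensorAt I f ξ p (L X) (L Y) = L (differenceTensorAt I f ξ p X Y)) ∧
    (∀ X, shapeAt I f ξ p (L X) = L (shapeAt I f ξ p X))}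

/-- The hypersurface `f` with affine normal `ξ` admits a pointwise `G`-symmetry on `U`, where `G`
is a group of matrices: at every point `h`, `K` and `S` are preserved by `G`, acting through some
Lorentz orthonormal basis of the tangent space. -/
def AdmitsPointwiseSymmetryOn (f ξ : M → Fin 4 → ℝ) (U : Set M)
    (G : Subgroup (Matrix.SpecialLinearGroup (Fin 3) ℝ)) : Prop :=
  ∀ p ∈ U, ∃ b : Module.Basis (Fin 3) ℝ E, IsLorentzONB (metricAt I f ξ p) b ∧
    (G : Set (Matrix.SpecialLinearGroup (Fin 3) ℝ)) ⊆ symmetriesAt I f ξ p b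

end Manifold

/-- The matrix `A_s` of the rotation by the angle `s` about the timelike axis of a Lorentz
orthonormal basis `(t, v, w)`. -/
def rotationMatrix (s : ℝ) : Matrix (Fin 3) (Fin 3) ℝ :=
  !![1, 0, 0;
    0, Real.cos s, -Real.sin s;
    0, Real.sin s, Real.cos s]

theorem det_rotationMatrix (s : ℝ) : (rotationMatrix s).det = 1 := by
  simp [rotationMatrix, Matrix.det_fin_three]
  nlinarith [Real.sin_sq_add_cos_sq s]

theorem rotationMatrix_zero : rotationMatrix 0 = 1 := by
  ext i j
  fin_cases i <;> fin_cases j <;> simp [rotationMatrix]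

theorem rotationMatrix_add (s u : ℝ) :
    rotationMatrix (s + u) = rotationMatrix s * rotationMatrix u := by
  ext i j
  fin_cases i <;> fin_cases j <;>
    simp [rotationMatrix, Matrix.mul_apply, Fin.sum_univ_three, Real.cos_add, Real.sin_add] <;>
    ring

/-- The homomorphism `s ↦ A_s` from the additive group `ℝ` to the matrices of determinant one. -/
def rotation : Multiplicative ℝ →* Matrix.SpecialLinearGroup (Fin 3) ℝ where
  toFun s := ⟨rotationMatrix s.toAdd, det_rotationMatrix s.toAdd⟩
  map_one' := Subtype.ext rotationMatrix_zero
  map_mul' s u := Subtype.ext (rotationMatrix_add s.toAdd u.toAdd)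

/-- `SO(2)`, the group of all rotations `A_s`. -/
def groupSO2 : Subgroup (Matrix.SpecialLinearGroup (Fin 3) ℝ) := rotation.range

/-- `ℤ₃`, the group generated by the rotation `A_{2π/3}`. -/
def groupZ3 : Subgroup (Matrix.SpecialLinearGroup (Fin 3) ℝ) :=
  Subgroup.zpowers (rotation (Multiplicative.ofAdd (2 * Real.pi / 3)))

/-- `φ : N → ℝ³` is a positive definite elliptic (`ε = 1`) or hyperbolic (`ε = -1`) affine sphere
centred at the origin, with affine mean curvature `ε`, i.e. with affine normal `-ε φ`. -/
def IsDefiniteProperAffineSphere {N : Type*} [TopologicalSpace N]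
    [ChartedSpace (EuclideanSpace ℝ (Fin 2)) N] (φ : N → Fin 3 → ℝ) (ε : ℝ) : Prop :=
  (ε = 1 ∨ ε = -1) ∧
  IsAffineHypersphereOn (𝓡 2) φ (fun q => -(ε • φ q)) ε Set.univ ∧
  ∀ q : N, ∀ X : EuclideanSpace ℝ (Fin 2), X ≠ 0 →
    0 < metricAt (𝓡 2) φ (fun q => -(ε • φ q)) q X X

/-- The map `(t, q) ↦ (γ₁(t), γ₂(t) φ(q))`. -/
def warp {N : Type*} (γ₁ γ₂ : ℝ → ℝ) (φ : N → Fin 3 → ℝ) : ℝ × N → Fin 4 → ℝ :=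
  fun x => Matrix.vecCons (γ₁ x.1) (γ₂ x.1 • φ x.2)

/-- The model of the product manifold `ℝ × N` for a surface `N`. -/
abbrev modelProd : ModelWithCorners ℝ (ℝ × EuclideanSpace ℝ (Fin 2))
    (ModelProd ℝ (EuclideanSpace ℝ (Fin 2))) :=
  𝓘(ℝ, ℝ).prod (𝓡 2)

end AffineGeom

end

open AffineGeom

/-!
In the frame `(∂ₜ, TN)` of the warped hypersurface `f(t, q) = (γ₁(t), γ₂(t) φ(q))`, the Gauss
equation makes the affine metric block diagonal, `h = a dt² + r g` with `g` the affine metric of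
`φ`, where `r` is, up to a factor depending on `t` only, the component of `(0, φ)` along the affine
normal. The volume condition forces this component to depend on `t` only. Hence the cubic form
`C = h(K ·, ·)` satisfies `C(X, ∂ₜ, ∂ₜ) = 0` and `C(∂ₜ, X, Y) = μ g(X, Y)` for `X`, `Y` tangent to
`N`. Since `C` is symmetric (Codazzi) and trace-free (apolarity), it is the sum of an
`SO(2)`-invariant part, determined by `K(𝐭, 𝐭)`, and a harmonic cubic polynomial on the
`(𝐯, 𝐰)`-plane. A rotation by the angle `s` about `𝐭` rotates the latter by `3 s`, so it preserves a
nonzero one if and only if `cos (3 s) = 1`. If `K(𝐭, 𝐭) ≠ 0`, then every symmetry fixes `𝐭`.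

Conversely, any `ξ = k e₀ - c f` satisfies `Dξ = -c df`, so the only conditions left are the volume
condition, which is the differential equation for `γ` with `(k, c) = (0, ±1)` or `(±1, 0)`, and the
signature of `h`, which is settled by the choice of the sign: the function that decides it has no
zero on the interval.
-/

open Filter Topology

namespace AffineGeom

section ContinuousLinear

variable {E F : Type*} [NormedAddCommGroup E] [NormedSpace ℝ E] [NormedAddCommGroup F]
  [NormedSpace ℝ F]

theorem isInvertible_of_bijective [CompleteSpace E] [CompleteSpace F] {L : E →L[ℝ] F}
    (hL : Function.Bijective L) : L.IsInvertible :=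
  ⟨ContinuousLinearEquiv.ofBijective L (LinearMap.ker_eq_bot.2 hL.1)
    (LinearMap.range_eq_top.2 hL.2), rfl⟩

theorem isInvertible_of_nondegenerate [FiniteDimensional ℝ E] {B : E →L[ℝ] E →L[ℝ] ℝ}
    (hB : ∀ X, (∀ Y, B X Y = 0) → X = 0) : B.IsInvertible := by
  have : CompleteSpace E := FiniteDimensional.complete ℝ E
  have hinj : Function.Injective B :=
    (injective_iff_map_eq_zero _).2 fun X hX => hB X fun Y => by rw [hX, zero_apply]
  have hrank : Module.finrank ℝ E = Module.finrank ℝ (E →L[ℝ] ℝ) :=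
    (Subspace.dual_finrank_eq (K := ℝ) (V := E)).symm.trans
      (LinearMap.toContinuousLinearMap (𝕜 := ℝ) (E := E) (F' := ℝ)).finrank_eq
  exact isInvertible_of_bijective ⟨hinj,
    (LinearMap.injective_iff_surjective_of_finrank_eq_finrank hrank (f := B.toLinearMap)).1 hinj⟩

theorem contDiffAt_fderiv_of_contDiffAt_infty {f : E → F} {y : E} (hf : ContDiffAt ℝ ∞ f y) :
    ContDiffAt ℝ ∞ (fderiv ℝ f) y :=
  hf.fderiv_right (by simp)

theorem hasFDerivAt_apply_apply {G : Type*} [NormedAddCommGroup G] [NormedSpace ℝ G]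
    {B : E → F →L[ℝ] F →L[ℝ] G} {D : E →L[ℝ] F →L[ℝ] F →L[ℝ] G} {y : E} (hB : HasFDerivAt B D y)
    (Y Z : F) : HasFDerivAt (fun z => B z Y Z) ((D.flip Y).flip Z) y := by
  simpa using (hB.clm_apply (hasFDerivAt_const Y y)).clm_apply (hasFDerivAt_const Z y)

theorem isSymmSndFDerivAt_of_contDiffAt_infty {f : E → F} {y : E} (hf : ContDiffAt ℝ ∞ f y) :
    IsSymmSndFDerivAt ℝ f y :=
  hf.isSymmSndFDerivAt (by
    rw [minSmoothness_of_isRCLikeNormedField]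
    exact WithTop.coe_le_coe.2 (le_top : (2 : ℕ∞) ≤ ⊤))

end ContinuousLinear

section Structure

variable {E : Type*} [NormedAddCommGroup E] [NormedSpace ℝ E] {n : ℕ}
  {f ξ : E → Fin (n + 1) → ℝ} {y : E}

theorem frame_apply (f ξ : E → Fin (n + 1) → ℝ) (y : E) (x : E × ℝ) :
    frame f ξ y x = fderiv ℝ f y x.1 + x.2 • ξ y := by
  simp [frame]

theorem metric_apply (f ξ : E → Fin (n + 1) → ℝ) (y X Y : E) :
    metric f ξ y X Y = (split f ξ y (fderiv ℝ (fderiv ℝ f) y X Y)).2 := rfl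

theorem metric_symm (hf : ContDiffAt ℝ ∞ f y) (X Y : E) :
    metric f ξ y X Y = metric f ξ y Y X := by
  rw [metric_apply, metric_apply, (isSymmSndFDerivAt_of_contDiffAt_infty hf).eq]

theorem inducedConnection_symm (hf : ContDiffAt ℝ ∞ f y) (X Y : E) :
    inducedConnection f ξ y X Y = inducedConnection f ξ y Y X := by
  rw [inducedConnection, inducedConnection, (isSymmSndFDerivAt_of_contDiffAt_infty hf).eq]

set_option maxSynthPendingDepth 3 in
/-- The Koszul form as a bilinear map of its two vector arguments; for `D` the derivative of the
metric, `swap (D.flip X) Y Z = D Z X Y`. -/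
noncomputable def koszulBilin (g : E → E →L[ℝ] E →L[ℝ] ℝ) (y : E) : E →L[ℝ] E →L[ℝ] E →L[ℝ] ℝ :=
  let swap : (E →L[ℝ] E →L[ℝ] ℝ) →L[ℝ] E →L[ℝ] E →L[ℝ] ℝ :=
    (ContinuousLinearMap.flipₗᵢ ℝ E E ℝ).toContinuousLinearEquiv
  (1 / 2 : ℝ) • (fderiv ℝ g y + (fderiv ℝ g y).flip - swap.comp (fderiv ℝ g y).flip)

/-- The difference tensor as a bilinear map. -/
noncomputable def differenceBilin (f ξ : E → Fin (n + 1) → ℝ) (y : E) : E →L[ℝ] E →L[ℝ] E :=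
  (ContinuousLinearMap.compL ℝ E _ E ((ContinuousLinearMap.fst ℝ E ℝ).comp (split f ξ y))).comp
      (fderiv ℝ (fderiv ℝ f) y) -
    (ContinuousLinearMap.compL ℝ E _ E (metric f ξ y).inverse).comp (koszulBilin (metric f ξ) y)

theorem differenceBilin_apply (X Y : E) :
    differenceBilin f ξ y X Y = differenceTensor f ξ y X Y := rfl

theorem finiteDimensional_of_injective_frame (h : Function.Injective (frame f ξ y)) :
    FiniteDimensional ℝ E :=
  Module.Finite.of_injective ((frame f ξ y).toLinearMap ∘ₗ LinearMap.inl ℝ E ℝ)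
    (h.comp LinearMap.inl_injective)

theorem isInvertible_frame (h : Function.Bijective (frame f ξ y)) :
    (frame f ξ y).IsInvertible := by
  have := finiteDimensional_of_injective_frame h.1
  have : CompleteSpace E := FiniteDimensional.complete ℝ E
  exact isInvertible_of_bijective h

theorem finrank_eq_of_bijective_frame (h : Function.Bijective (frame f ξ y)) :
    Module.finrank ℝ E = n := by
  have := finiteDimensional_of_injective_frame h.1
  have hrank := (LinearEquiv.ofBijective (frame f ξ y).toLinearMap h).finrank_eq
  simpa using hrank

theorem split_frame (h : Function.Bijective (frame f ξ y)) (x : E × ℝ) :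
    split f ξ y (frame f ξ y x) = x :=
  (isInvertible_frame h).inverse_apply_self x

theorem frame_split (h : Function.Bijective (frame f ξ y)) (v : Fin (n + 1) → ℝ) :
    frame f ξ y (split f ξ y v) = v :=
  (isInvertible_frame h).self_apply_inverse v

theorem split_add_smul (h : Function.Bijective (frame f ξ y)) (X : E) (c : ℝ) :
    split f ξ y (fderiv ℝ f y X + c • ξ y) = (X, c) := by
  rw [← split_frame h (X, c), frame_apply]

theorem split_fderiv (h : Function.Bijective (frame f ξ y)) (X : E) :
    split f ξ y (fderiv ℝ f y X) = (X, 0) := by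
  simpa using split_add_smul h X 0

theorem split_normal (h : Function.Bijective (frame f ξ y)) :
    split f ξ y (ξ y) = (0, 1) := by
  simpa using split_add_smul h 0 1

theorem fderiv_split_add (h : Function.Bijective (frame f ξ y)) (v : Fin (n + 1) → ℝ) :
    fderiv ℝ f y (split f ξ y v).1 + (split f ξ y v).2 • ξ y = v := by
  rw [← frame_apply, frame_split h]

theorem gauss (h : Function.Bijective (frame f ξ y)) (X Y : E) :
    fderiv ℝ (fderiv ℝ f) y X Y =
      fderiv ℝ f y (inducedConnection f ξ y X Y) + metric f ξ y X Y • ξ y :=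
  (fderiv_split_add h _).symm

theorem transversalForm_eq_zero (h : Function.Bijective (frame f ξ y)) {c : ℝ} {X : E}
    (hξ : fderiv ℝ ξ y X = (-c) • fderiv ℝ f y X) : transversalForm f ξ y X = 0 := by
  rw [transversalForm, hξ, map_smul, split_fderiv h, Prod.smul_snd, smul_zero]

theorem shape_eq_smul (h : Function.Bijective (frame f ξ y)) {c : ℝ} {X : E}
    (hξ : fderiv ℝ ξ y X = (-c) • fderiv ℝ f y X) : shape f ξ y X = c • X := by
  rw [shape, hξ, map_smul, split_fderiv h, Prod.smul_fst, neg_smul, neg_neg]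

theorem contDiffAt_frame (hf : ContDiffAt ℝ ∞ f y) (hξ : ContDiffAt ℝ ∞ ξ y) :
    ContDiffAt ℝ ∞ (frame f ξ) y := by
  have hframe : frame f ξ = fun z => (fderiv ℝ f z).comp (ContinuousLinearMap.fst ℝ E ℝ) +
      (ContinuousLinearMap.smulRightL ℝ (E × ℝ) _ (ContinuousLinearMap.snd ℝ E ℝ)) (ξ z) := by
    ext z x <;> simp [frame]
  rw [hframe]
  exact ((contDiffAt_fderiv_of_contDiffAt_infty hf).clm_comp contDiffAt_const).add
    ((ContinuousLinearMap.contDiff _).contDiffAt.comp y hξ)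

theorem contDiffAt_split (hf : ContDiffAt ℝ ∞ f y) (hξ : ContDiffAt ℝ ∞ ξ y)
    (h : Function.Bijective (frame f ξ y)) : ContDiffAt ℝ ∞ (split f ξ) y := by
  have := finiteDimensional_of_injective_frame h.1
  have : CompleteSpace E := FiniteDimensional.complete ℝ E
  exact (isInvertible_frame h).contDiffAt_map_inverse.comp y (contDiffAt_frame hf hξ)

theorem contDiffAt_metric (hf : ContDiffAt ℝ ∞ f y) (hξ : ContDiffAt ℝ ∞ ξ y)
    (h : Function.Bijective (frame f ξ y)) : ContDiffAt ℝ ∞ (metric f ξ) y :=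
  ((ContinuousLinearMap.contDiff _).contDiffAt.comp y
    (contDiffAt_const.clm_comp (contDiffAt_split hf hξ h))).clm_comp
    (contDiffAt_fderiv_of_contDiffAt_infty (contDiffAt_fderiv_of_contDiffAt_infty hf))

/-- The transversal part of the Gauss formula for the field `V = f_* X_V + σ ξ` along `f`, of which
the second derivative of `f` and the radial fields below are instances. -/
theorem split_fderiv_snd (hf : ContDiffAt ℝ ∞ f y) (hξ : ContDiffAt ℝ ∞ ξ y)
    (h : ∀ᶠ z in 𝓝 y, Function.Bijective (frame f ξ z)) (ht : ∀ X, transversalForm f ξ y X = 0)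
    {V : E → Fin (n + 1) → ℝ} (hV : DifferentiableAt ℝ V y) (X : E) :
    (split f ξ y (fderiv ℝ V y X)).2 =
      metric f ξ y X (split f ξ y (V y)).1 +
        fderiv ℝ (fun z => (split f ξ z (V z)).2) y X := by
  have hy := h.self_of_nhds
  have hσ : DifferentiableAt ℝ (fun z => split f ξ z (V z)) y :=
    ((contDiffAt_split hf hξ hy).differentiableAt (by simp)).clm_apply hV
  have hf' := (contDiffAt_fderiv_of_contDiffAt_infty hf).differentiableAt (by simp)
  have hξ' : DifferentiableAt ℝ ξ y := hξ.differentiableAt (by simp)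
  have hdecomp : V =ᶠ[𝓝 y] fun z => fderiv ℝ f z (split f ξ z (V z)).1 +
      (split f ξ z (V z)).2 • ξ z := by
    filter_upwards [h] with z hz using (fderiv_split_add hz _).symm
  have hderiv := (((hf'.hasFDerivAt.clm_apply hσ.hasFDerivAt.fst).add
    (hσ.hasFDerivAt.snd.smul hξ'.hasFDerivAt)).congr_of_eventuallyEq hdecomp).fderiv
  have hsnd : fderiv ℝ (fun z => (split f ξ z (V z)).2) y X =
      (fderiv ℝ (fun z => split f ξ z (V z)) y X).2 := by
    rw [hσ.hasFDerivAt.snd.fderiv]; rfl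
  have hτ : (split f ξ y (fderiv ℝ ξ y X)).2 = 0 := ht X
  rw [hsnd, metric_apply]
  simpa [split_fderiv hy, split_normal hy, hτ] using
    congrArg (fun L => (split f ξ y (L X)).2) hderiv

end Structure

section Codazzi

variable {E : Type*} [NormedAddCommGroup E] [NormedSpace ℝ E] {n : ℕ}
  {f ξ : E → Fin (n + 1) → ℝ} {y : E}

/-- `f` and `ξ` are smooth and `ξ` is a Blaschke normal of `f`, all in a neighbourhood of `y`: the
hypothesis under which the structure equations of `f` can be differentiated at `y`. -/
def IsBlaschkeNear (f ξ : E → Fin (n + 1) → ℝ) (y : E) : Prop :=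
  ∀ᶠ z in 𝓝 y, ContDiffAt ℝ ∞ f z ∧ ContDiffAt ℝ ∞ ξ z ∧ IsBlaschkeNormalAt f ξ z

namespace IsBlaschkeNear

theorem contDiffAt (H : IsBlaschkeNear f ξ y) : ContDiffAt ℝ ∞ f y :=
  H.self_of_nhds.1

theorem contDiffAt_normal (H : IsBlaschkeNear f ξ y) : ContDiffAt ℝ ∞ ξ y :=
  H.self_of_nhds.2.1

theorem isBlaschkeNormalAt (H : IsBlaschkeNear f ξ y) : IsBlaschkeNormalAt f ξ y :=
  H.self_of_nhds.2.2

theorem bijective_frame (H : IsBlaschkeNear f ξ y) : Function.Bijective (frame f ξ y) :=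
  H.isBlaschkeNormalAt.transversal

theorem eventually_bijective_frame (H : IsBlaschkeNear f ξ y) :
    ∀ᶠ z in 𝓝 y, Function.Bijective (frame f ξ z) :=
  H.mono fun _ h => h.2.2.transversal

theorem differentiableAt_metric (H : IsBlaschkeNear f ξ y) :
    DifferentiableAt ℝ (metric f ξ) y :=
  (contDiffAt_metric H.contDiffAt H.contDiffAt_normal H.bijective_frame).differentiableAt (by simp)

theorem hasFDerivAt_metric_apply (H : IsBlaschkeNear f ξ y) (Y Z : E) :
    HasFDerivAt (fun z => metric f ξ z Y Z) (((fderiv ℝ (metric f ξ) y).flip Y).flip Z) y :=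
  hasFDerivAt_apply_apply H.differentiableAt_metric.hasFDerivAt Y Z

theorem fderiv_metric_symm (H : IsBlaschkeNear f ξ y) (X Y Z : E) :
    fderiv ℝ (metric f ξ) y X Y Z = fderiv ℝ (metric f ξ) y X Z Y := by
  have hsymm : (fun z => metric f ξ z Y Z) =ᶠ[𝓝 y] fun z => metric f ξ z Z Y :=
    H.mono fun z hz => metric_symm hz.1 Y Z
  exact congrArg (· X) ((H.hasFDerivAt_metric_apply Y Z).unique
    ((H.hasFDerivAt_metric_apply Z Y).congr_of_eventuallyEq hsymm))

theorem split_third_fderiv_snd (H : IsBlaschkeNear f ξ y) (X Y Z : E) :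
    (split f ξ y (fderiv ℝ (fderiv ℝ (fderiv ℝ f)) y X Y Z)).2 =
      fderiv ℝ (metric f ξ) y X Y Z + metric f ξ y X (inducedConnection f ξ y Y Z) := by
  have hf'' := (contDiffAt_fderiv_of_contDiffAt_infty
    (contDiffAt_fderiv_of_contDiffAt_infty H.contDiffAt)).differentiableAt (by simp)
  have hV := hasFDerivAt_apply_apply hf''.hasFDerivAt Y Z
  have hsplit := split_fderiv_snd H.contDiffAt H.contDiffAt_normal H.eventually_bijective_frame
    H.isBlaschkeNormalAt.tangential hV.differentiableAt X
  have hmetric : fderiv ℝ (fun z => (split f ξ z (fderiv ℝ (fderiv ℝ f) z Y Z)).2) y X =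
      fderiv ℝ (metric f ξ) y X Y Z :=
    congrArg (· X) (H.hasFDerivAt_metric_apply Y Z).fderiv
  rw [hV.fderiv, hmetric] at hsplit
  exact hsplit.trans (add_comm _ _)

/-- The transversal part of the symmetry of the third derivative of `f`. -/
theorem codazzi (H : IsBlaschkeNear f ξ y) (X Y Z : E) :
    fderiv ℝ (metric f ξ) y X Y Z + metric f ξ y X (inducedConnection f ξ y Y Z) =
      fderiv ℝ (metric f ξ) y Y X Z + metric f ξ y Y (inducedConnection f ξ y X Z) := by
  rw [← H.split_third_fderiv_snd, ← H.split_third_fderiv_snd,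
    (isSymmSndFDerivAt_of_contDiffAt_infty
      (contDiffAt_fderiv_of_contDiffAt_infty H.contDiffAt)).eq]

theorem metric_leviCivita (H : IsBlaschkeNear f ξ y) (X Y Z : E) :
    metric f ξ y (leviCivita (metric f ξ) y X Y) Z = koszulForm (metric f ξ) y X Y Z := by
  have := finiteDimensional_of_injective_frame H.bijective_frame.1
  rw [leviCivita, (isInvertible_of_nondegenerate
    H.isBlaschkeNormalAt.nondegenerate).self_apply_inverse]

/-- The cubic form `h(K(X, Y), Z)` is `-½ (∇h)(X; Y, Z)`: by the Codazzi equation the three terms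
of the Koszul formula coincide up to Christoffel terms. -/
theorem metric_differenceTensor (H : IsBlaschkeNear f ξ y) (X Y Z : E) :
    metric f ξ y (differenceTensor f ξ y X Y) Z =
      -(1 / 2) * (fderiv ℝ (metric f ξ) y X Y Z
        - metric f ξ y (inducedConnection f ξ y X Y) Z
        - metric f ξ y Y (inducedConnection f ξ y X Z)) := by
  have hf := H.contDiffAt
  have codazzi₁ := H.codazzi X Y Z
  have codazzi₂ := H.codazzi X Z Y
  have codazzi₃ := H.codazzi Y Z X
  rw [H.fderiv_metric_symm X Z Y, inducedConnection_symm hf Z Y] at codazzi₂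
  rw [H.fderiv_metric_symm Y Z X, H.fderiv_metric_symm Z Y X, inducedConnection_symm hf Z X,
    inducedConnection_symm hf Y X] at codazzi₃
  rw [differenceTensor, map_sub, sub_apply, H.metric_leviCivita,
    metric_symm hf (inducedConnection f ξ y X Y) Z]
  simp only [koszulForm, smul_apply, add_apply, sub_apply, ContinuousLinearMap.flip_apply,
    smul_eq_mul]
  linarith

theorem metric_differenceTensor_symm (H : IsBlaschkeNear f ξ y) (X Y Z : E) :
    metric f ξ y (differenceTensor f ξ y X Y) Z = metric f ξ y (differenceTensor f ξ y Y X) Z := by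
  rw [H.metric_differenceTensor, H.metric_differenceTensor,
    inducedConnection_symm H.contDiffAt Y X]
  linarith [H.codazzi X Y Z]

theorem metric_differenceTensor_symm_right (H : IsBlaschkeNear f ξ y) (X Y Z : E) :
    metric f ξ y (differenceTensor f ξ y X Y) Z = metric f ξ y (differenceTensor f ξ y X Z) Y := by
  have hf := H.contDiffAt
  rw [H.metric_differenceTensor, H.metric_differenceTensor, H.fderiv_metric_symm X Y Z,
    metric_symm hf (inducedConnection f ξ y X Y), metric_symm hf (inducedConnection f ξ y X Z)]
  ring

end IsBlaschkeNear

end Codazzi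

section Determinant

variable {ι : Type*} [Fintype ι] [DecidableEq ι] {M : ℝ → Matrix ι ι ℝ} {s : ℝ}

theorem hasDerivAt_det {M' : Matrix ι ι ℝ} (h : ∀ i j, HasDerivAt (fun t => M t i j) (M' i j) s) :
    HasDerivAt (fun t => (M t).det) ((M s).adjugate * M').trace s := by
  let D : ContinuousMultilinearMap ℝ (fun _ : ι => ι → ℝ) ℝ :=
    { (Matrix.detRowAlternating (R := ℝ) (n := ι)).toMultilinearMap with
      cont := by
        change Continuous fun A : Matrix ι ι ℝ => A.det
        fun_prop }
  have hM : HasDerivAt (fun t => (M t : ι → ι → ℝ)) M' s :=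
    hasDerivAt_pi.2 fun i => hasDerivAt_pi.2 fun j => h i j
  have hD : D.linearDeriv (M s) M' = ((M s).adjugate * M').trace := by
    refine (ContinuousMultilinearMap.linearDeriv_apply D (M s) M').trans ?_
    change ∑ i, ((M s).updateRow i (M' i)).det = _
    simp only [← Matrix.cramer_transpose_apply, Matrix.cramer_eq_adjugate_mulVec,
      ← Matrix.adjugate_transpose, Matrix.mulVec, dotProduct, Matrix.transpose_apply, Matrix.trace,
      Matrix.diag, Matrix.mul_apply]
    exact Finset.sum_comm
  rw [← hD]
  exact (D.hasFDerivAt (M s)).comp_hasDerivAt s hM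

theorem hasDerivAt_det_mul {B : Matrix ι ι ℝ}
    (h : ∀ i j, HasDerivAt (fun t => M t i j) ((B * M s) i j) s) :
    HasDerivAt (fun t => (M t).det) (B.trace * (M s).det) s := by
  convert hasDerivAt_det h using 1
  rw [Matrix.trace_mul_comm, Matrix.mul_assoc, Matrix.mul_adjugate, Matrix.mul_smul,
    Matrix.mul_one, Matrix.trace_smul, smul_eq_mul, mul_comm]

theorem hasDerivAt_det_gram {P : Matrix ι ι ℝ}
    (h : ∀ i j, HasDerivAt (fun t => M t i j) ((P * M s + M s * P.transpose) i j) s) :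
    HasDerivAt (fun t => (M t).det) (2 * P.trace * (M s).det) s := by
  convert hasDerivAt_det h using 1
  rw [Matrix.mul_add, Matrix.trace_add, Matrix.trace_mul_comm, Matrix.mul_assoc,
    Matrix.mul_adjugate, ← Matrix.mul_assoc, Matrix.adjugate_mul, Matrix.mul_smul, Matrix.smul_mul,
    Matrix.mul_one, Matrix.one_mul, Matrix.trace_smul, Matrix.trace_smul, Matrix.trace_transpose,
    smul_eq_mul]
  ring

end Determinant

section Frame

variable {E : Type*} [NormedAddCommGroup E] [NormedSpace ℝ E] {n : ℕ}
  {f ξ : E → Fin (n + 1) → ℝ} {y : E}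

/-- The Gram matrix of a family of vectors with respect to a bilinear form. -/
noncomputable def gramMatrix {ι : Type*} (B : E →L[ℝ] E →L[ℝ] ℝ) (X : ι → E) : Matrix ι ι ℝ :=
  Matrix.of fun i j => B (X i) (X j)

/-- The matrix with the rows `f_* X₁, …, f_* Xₙ, ξ`, whose determinant is the induced volume. -/
noncomputable def frameMatrix (f ξ : E → Fin (n + 1) → ℝ) (X : Fin n → E) (y : E) :
    Matrix (Fin (n + 1)) (Fin (n + 1)) ℝ :=
  Matrix.of (Fin.snoc (α := fun _ => Fin (n + 1) → ℝ) (fun i => fderiv ℝ f y (X i)) (ξ y))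

theorem frameMatrix_castSucc (X : Fin n → E) (i : Fin n) :
    frameMatrix f ξ X y i.castSucc = fderiv ℝ f y (X i) := by
  ext j
  simp [frameMatrix]

theorem frameMatrix_last (X : Fin n → E) : frameMatrix f ξ X y (Fin.last n) = ξ y := by
  ext j
  simp [frameMatrix]

/-- The coordinates of a vector of `ℝⁿ⁺¹` with respect to `f_* b₁, …, f_* bₙ, ξ`. -/
noncomputable def frameCoord (f ξ : E → Fin (n + 1) → ℝ) (b : Module.Basis (Fin n) ℝ E) (y : E)
    (v : Fin (n + 1) → ℝ) : Fin (n + 1) → ℝ :=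
  Fin.snoc (α := fun _ => ℝ) (fun i => b.repr (split f ξ y v).1 i) (split f ξ y v).2

theorem sum_snoc_repr_smul_frameMatrix (b : Module.Basis (Fin n) ℝ E) (x : E × ℝ) :
    ∑ k, Fin.snoc (α := fun _ => ℝ) (b.repr x.1) x.2 k • frameMatrix f ξ b y k =
      frame f ξ y x := by
  have hsum := congrArg (fderiv ℝ f y) (b.sum_repr x.1)
  rw [map_sum] at hsum
  rw [frame_apply, ← hsum]
  simp [Fin.sum_univ_castSucc, frameMatrix_castSucc, frameMatrix_last]

theorem sum_frameCoord_smul (h : Function.Bijective (frame f ξ y)) (b : Module.Basis (Fin n) ℝ E)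
    (v : Fin (n + 1) → ℝ) : ∑ k, frameCoord f ξ b y v k • frameMatrix f ξ b y k = v :=
  (sum_snoc_repr_smul_frameMatrix b (split f ξ y v)).trans (frame_split h v)

theorem frameCoord_mul_frameMatrix (h : Function.Bijective (frame f ξ y))
    (b : Module.Basis (Fin n) ℝ E) (V : Matrix (Fin (n + 1)) (Fin (n + 1)) ℝ) :
    Matrix.of (fun i => frameCoord f ξ b y (V i)) * frameMatrix f ξ b y = V := by
  ext i j
  simpa [Matrix.mul_apply] using congrFun (sum_frameCoord_smul h b (V i)) j

theorem det_frameMatrix_ne_zero (h : Function.Bijective (frame f ξ y))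
    (b : Module.Basis (Fin n) ℝ E) : (frameMatrix f ξ b y).det ≠ 0 := fun h0 => by
  simpa [h0] using congrArg Matrix.det (frameCoord_mul_frameMatrix h b 1)

theorem bijective_frame_of_det_frameMatrix_ne_zero (b : Module.Basis (Fin n) ℝ E)
    (h : (frameMatrix f ξ b y).det ≠ 0) : Function.Bijective (frame f ξ y) := by
  have hinj : Function.Injective (frame f ξ y) :=
    (injective_iff_map_eq_zero _).2 fun x hx => by
      have hsnoc := Matrix.eq_zero_of_vecMul_eq_zero h
        ((Matrix.vecMul_eq_sum _ _).trans ((sum_snoc_repr_smul_frameMatrix b x).trans hx))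
      refine Prod.ext (b.ext_elem fun i => ?_) ?_
      · simpa using congrFun hsnoc i.castSucc
      · simpa using congrFun hsnoc (Fin.last n)
  have := finiteDimensional_of_injective_frame hinj
  exact ⟨hinj, (LinearMap.injective_iff_surjective_of_finrank_eq_finrank
    (f := (frame f ξ y).toLinearMap) (by simp [Module.finrank_eq_card_basis b])).1 hinj⟩

theorem split_snd_mul_det_frameMatrix (h : Function.Bijective (frame f ξ y))
    (b : Module.Basis (Fin n) ℝ E) (v : Fin (n + 1) → ℝ) :
    (split f ξ y v).2 * (frameMatrix f ξ b y).det = (frameMatrix f (fun _ => v) b y).det := by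
  have hrow : frameMatrix f (fun _ => v) b y = (frameMatrix f ξ b y).updateRow (Fin.last n)
      (∑ k, frameCoord f ξ b y v k • frameMatrix f ξ b y k) := by
    rw [sum_frameCoord_smul h]
    refine funext (Fin.lastCases ?_ fun i => ?_)
    · rw [Matrix.updateRow_self, frameMatrix_last]
    · rw [Matrix.updateRow_ne (Fin.castSucc_ne_last i), frameMatrix_castSucc, frameMatrix_castSucc]
  rw [hrow, Matrix.det_updateRow_sum]
  simp [frameCoord]

theorem det_frameMatrix_eq (b : Module.Basis (Fin n) ℝ E) (X : Fin n → E) :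
    (frameMatrix f ξ X y).det = b.det X * (frameMatrix f ξ b y).det := by
  let det := (Matrix.detRowAlternating (R := ℝ) (n := Fin (n + 1))).toMultilinearMap
  let vol : E [⋀^Fin n]→ₗ[ℝ] ℝ :=
    { toMultilinearMap := ((LinearMap.applyₗ (ξ y)).compMultilinearMap
        det.curryRight).compLinearMap fun _ => (fderiv ℝ f y).toLinearMap
      map_eq_zero_of_eq' := fun v i j hij hne => by
        refine Matrix.det_zero_of_row_eq (i := i.castSucc) (j := j.castSucc) (by simpa using hne) ?_
        ext k
        simp [hij] }
  exact (congrArg (· X) (vol.eq_smul_basis_det b)).trans (mul_comm _ _)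

theorem det_gramMatrix_eq {ι : Type*} [Fintype ι] [DecidableEq ι] (B : E →L[ℝ] E →L[ℝ] ℝ)
    (b : Module.Basis ι ℝ E) (X : ι → E) :
    (gramMatrix B X).det = b.det X ^ 2 * (gramMatrix B b).det := by
  have hgram : gramMatrix B X = (b.toMatrix X).transpose * gramMatrix B b * b.toMatrix X := by
    ext i j
    have hX : ∀ i, X i = ∑ k, b.toMatrix X k i • b k := fun i => (b.sum_repr (X i)).symm
    simp only [gramMatrix, Matrix.of_apply, Matrix.mul_apply, Matrix.transpose_apply]
    rw [hX i, hX j]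
    simp only [map_sum, map_smul, sum_apply, smul_apply, smul_eq_mul, Finset.mul_sum,
      Finset.sum_mul]
    exact Finset.sum_congr rfl fun k _ => Finset.sum_congr rfl fun l _ => by ring
  rw [hgram, Matrix.det_mul, Matrix.det_mul, Matrix.det_transpose, Module.Basis.det_apply]
  ring

theorem abs_eq_sqrt_abs_iff {a b : ℝ} : |a| = √|b| ↔ a ^ 2 = |b| := by
  rw [eq_comm, Real.sqrt_eq_iff_eq_sq (abs_nonneg b) (abs_nonneg a), sq_abs, eq_comm]

theorem IsBlaschkeNormalAt.sq_det_frameMatrix (h : IsBlaschkeNormalAt f ξ y) (X : Fin n → E) :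
    (frameMatrix f ξ X y).det ^ 2 = |(gramMatrix (metric f ξ y) X).det| :=
  abs_eq_sqrt_abs_iff.1 (h.volume_eq X)

theorem abs_det_frameMatrix_eq_sqrt_of_basis (b : Module.Basis (Fin n) ℝ E)
    (h : (frameMatrix f ξ b y).det ^ 2 = |(gramMatrix (metric f ξ y) b).det|) (X : Fin n → E) :
    |(frameMatrix f ξ X y).det| = √|(gramMatrix (metric f ξ y) X).det| := by
  rw [abs_eq_sqrt_abs_iff, det_frameMatrix_eq b, det_gramMatrix_eq _ b, mul_pow, h, abs_mul,
    abs_of_nonneg (sq_nonneg (b.det X))]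

end Frame

section Apolarity

variable {E : Type*} [NormedAddCommGroup E] [NormedSpace ℝ E] {n : ℕ}
  {f ξ : E → Fin (n + 1) → ℝ} {y : E}

theorem hasLineDerivAt_det_frameMatrix (hf : ContDiffAt ℝ ∞ f y) (hξ : ContDiffAt ℝ ∞ ξ y)
    (h : Function.Bijective (frame f ξ y)) (ht : ∀ X, transversalForm f ξ y X = 0)
    (b : Module.Basis (Fin n) ℝ E) (X : E) :
    HasLineDerivAt ℝ (fun z => (frameMatrix f ξ b z).det)
      ((∑ i, b.repr (inducedConnection f ξ y X (b i)) i) * (frameMatrix f ξ b y).det) y X := by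
  let V : Fin (n + 1) → Fin (n + 1) → ℝ :=
    Fin.snoc (α := fun _ => Fin (n + 1) → ℝ) (fun i => fderiv ℝ (fderiv ℝ f) y X (b i))
      (fderiv ℝ ξ y X)
  let B : Matrix (Fin (n + 1)) (Fin (n + 1)) ℝ := Matrix.of fun i => frameCoord f ξ b y (V i)
  have hBV : B * frameMatrix f ξ b y = Matrix.of V := frameCoord_mul_frameMatrix h b (Matrix.of V)
  have htrace : B.trace = ∑ i, b.repr (inducedConnection f ξ y X (b i)) i := by
    have hτ : (split f ξ y (fderiv ℝ ξ y X)).2 = 0 := ht X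
    simp [Matrix.trace, Fin.sum_univ_castSucc, B, V, frameCoord, hτ, inducedConnection]
  have hf' := (contDiffAt_fderiv_of_contDiffAt_infty hf).differentiableAt (by simp)
  have hy : y + (0 : ℝ) • X = y := by simp
  suffices hM : ∀ i j, HasLineDerivAt ℝ (fun z => frameMatrix f ξ b z i j) (V i j) y X by
    have hdet := hasDerivAt_det_mul (M := fun t : ℝ => frameMatrix f ξ b (y + t • X)) (B := B)
      (s := 0) fun i j => by
        rw [hy, hBV]
        exact hM i j
    rwa [hy, htrace] at hdet
  intro i j
  refine Fin.lastCases ?_ (fun i => ?_) i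
  · simpa [frameMatrix_last, V] using
      (hasFDerivAt_pi'.1 (hξ.differentiableAt (by simp)).hasFDerivAt j).hasLineDerivAt X
  · have hrow := hf'.hasFDerivAt.clm_apply (hasFDerivAt_const (b i) y)
    simpa [frameMatrix_castSucc, V] using (hasFDerivAt_pi'.1 hrow j).hasLineDerivAt X

namespace IsBlaschkeNear

theorem fderiv_metric_eq_leviCivita (H : IsBlaschkeNear f ξ y) (X Y Z : E) :
    fderiv ℝ (metric f ξ) y X Y Z =
      metric f ξ y (leviCivita (metric f ξ) y X Y) Z +
        metric f ξ y (leviCivita (metric f ξ) y X Z) Y := by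
  rw [H.metric_leviCivita, H.metric_leviCivita]
  simp only [koszulForm, smul_apply, add_apply, sub_apply, ContinuousLinearMap.flip_apply,
    smul_eq_mul]
  rw [H.fderiv_metric_symm X Z Y]
  ring

theorem hasLineDerivAt_det_gramMatrix (H : IsBlaschkeNear f ξ y) {ι : Type*} [Fintype ι]
    [DecidableEq ι] (b : Module.Basis ι ℝ E) (X : E) :
    HasLineDerivAt ℝ (fun z => (gramMatrix (metric f ξ z) b).det)
      (2 * (∑ i, b.repr (leviCivita (metric f ξ) y X (b i)) i) *
        (gramMatrix (metric f ξ y) b).det) y X := by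
  let P : Matrix ι ι ℝ := Matrix.of fun i j => b.repr (leviCivita (metric f ξ) y X (b i)) j
  let G : Matrix ι ι ℝ := gramMatrix (metric f ξ y) b
  have hP : ∀ i j, (P * G) i j = metric f ξ y (leviCivita (metric f ξ) y X (b i)) (b j) := by
    intro i j
    have hsum := congrArg (fun v => metric f ξ y v (b j))
      (b.sum_repr (leviCivita (metric f ξ) y X (b i)))
    simpa only [map_sum, map_smul, sum_apply, smul_apply, smul_eq_mul, P, G, gramMatrix,
      Matrix.mul_apply, Matrix.of_apply] using hsum
  have hG : G.transpose = G := by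
    ext i j
    exact metric_symm H.contDiffAt (b j) (b i)
  have hP' : (G * P.transpose) = (P * G).transpose := by rw [Matrix.transpose_mul, hG]
  have hy : y + (0 : ℝ) • X = y := by simp
  have hdet := hasDerivAt_det_gram (M := fun t : ℝ => gramMatrix (metric f ξ (y + t • X)) b)
    (P := P) (s := 0) fun i j => by
      rw [hy, Matrix.add_apply, hP', Matrix.transpose_apply, hP, hP,
        ← H.fderiv_metric_eq_leviCivita]
      exact (H.hasFDerivAt_metric_apply (b i) (b j)).hasLineDerivAt X
  rwa [hy] at hdet

/-- The volume condition equates the parallel volume of `∇` with that of `∇̂`, so `∇_X` and `∇̂_X`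
have the same trace. -/
theorem apolarity (H : IsBlaschkeNear f ξ y) (b : Module.Basis (Fin n) ℝ E) (X : E) :
    ∑ i, b.repr (differenceTensor f ξ y X (b i)) i = 0 := by
  have hB := H.isBlaschkeNormalAt
  have hθ := hasLineDerivAt_det_frameMatrix H.contDiffAt H.contDiffAt_normal hB.transversal
    hB.tangential b X
  have hG := H.hasLineDerivAt_det_gramMatrix b X
  have hvolume : (fun z => (frameMatrix f ξ b z).det ^ 4) =ᶠ[𝓝 y]
      fun z => (gramMatrix (metric f ξ z) b).det ^ 2 := by
    filter_upwards [H] with z hz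
    rw [show 4 = 2 * 2 from rfl, pow_mul, hz.2.2.sq_det_frameMatrix, sq_abs]
  have hG2 : HasLineDerivAt ℝ (fun z => (gramMatrix (metric f ξ z) b).det ^ 2) _ y X :=
    HasDerivAt.fun_pow hG 2
  have hderiv := (HasDerivAt.fun_pow hθ 4).unique (hG2.congr_of_eventuallyEq hvolume)
  have hvolume_y := hvolume.self_of_nhds
  simp only [zero_smul, add_zero, Nat.add_one_sub_one, Nat.cast_ofNat, pow_one] at hderiv
  simp only [differenceTensor, map_sub, Finsupp.sub_apply, Finset.sum_sub_distrib]
  refine (mul_eq_zero.1 ?_).resolve_left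
    (pow_ne_zero 4 (det_frameMatrix_ne_zero hB.transversal b))
  linear_combination hderiv / 4 -
    (∑ i, b.repr (leviCivita (metric f ξ) y X (b i)) i) * hvolume_y

end IsBlaschkeNear

end Apolarity

section Lorentz

variable {E : Type*} [NormedAddCommGroup E] [NormedSpace ℝ E]
  {h : E →L[ℝ] E →L[ℝ] ℝ} {b : Module.Basis (Fin 3) ℝ E}

theorem sum_repr_three (b : Module.Basis (Fin 3) ℝ E) (v : E) :
    b.repr v 0 • b 0 + b.repr v 1 • b 1 + b.repr v 2 • b 2 = v := by
  rw [← Fin.sum_univ_three fun i => b.repr v i • b i, b.sum_repr]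

namespace IsLorentzONB

theorem apply_basis (hb : IsLorentzONB h b) (v : E) (i : Fin 3) :
    h v (b i) = ![-1, 1, 1] i * b.repr v i := by
  conv_lhs => rw [← b.sum_repr v]
  simp only [map_sum, map_smul, sum_apply, smul_apply, smul_eq_mul, hb _ i,
    Matrix.diagonal_apply, mul_ite, mul_zero, Finset.sum_ite_eq', Finset.mem_univ, if_true]
  exact mul_comm _ _

theorem repr_zero (hb : IsLorentzONB h b) (v : E) : b.repr v 0 = -h v (b 0) := by
  simp [hb.apply_basis]

theorem repr_one (hb : IsLorentzONB h b) (v : E) : b.repr v 1 = h v (b 1) := by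
  simp [hb.apply_basis]

theorem repr_two (hb : IsLorentzONB h b) (v : E) : b.repr v 2 = h v (b 2) := by
  simp [hb.apply_basis]

theorem ext (hb : IsLorentzONB h b) {v w : E} (hvw : ∀ i, h v (b i) = h w (b i)) : v = w := by
  refine b.ext_elem (Fin.forall_fin_succ.2 ⟨?_, Fin.forall_fin_two.2 ⟨?_, ?_⟩⟩)
  · rw [hb.repr_zero, hb.repr_zero, hvw]
  · exact (hb.repr_one v).trans ((hvw 1).trans (hb.repr_one w).symm)
  · exact (hb.repr_two v).trans ((hvw 2).trans (hb.repr_two w).symm)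

theorem apply_apply (hb : IsLorentzONB h b) (v w : E) :
    h v w = -(b.repr v 0 * b.repr w 0) + b.repr v 1 * b.repr w 1 + b.repr v 2 * b.repr w 2 := by
  conv_lhs => rw [← sum_repr_three b w]
  simp only [map_add, map_smul, smul_eq_mul, hb.repr_zero v, hb.repr_one, hb.repr_two]
  ring

end IsLorentzONB

/-- The symmetric bilinear map `K` has the normal form of a difference tensor with a pointwise
`ℤ₃`-symmetry, with respect to the basis `b = (t, v, w)`. -/
structure IsNormalForm (K : E →ₗ[ℝ] E →ₗ[ℝ] E) (b : Module.Basis (Fin 3) ℝ E) (l r q : ℝ) :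
    Prop where
  symm : ∀ X Y, K X Y = K Y X
  tt : K (b 0) (b 0) = l • b 0
  tv : K (b 0) (b 1) = (-(l / 2)) • b 1
  tw : K (b 0) (b 2) = (-(l / 2)) • b 2
  vv : K (b 1) (b 1) = (l / 2) • b 0 + r • b 1 + q • b 2
  vw : K (b 1) (b 2) = q • b 1 - r • b 2
  ww : K (b 2) (b 2) = (l / 2) • b 0 - r • b 1 - q • b 2

namespace IsNormalForm

variable {K : E →ₗ[ℝ] E →ₗ[ℝ] E} {l r q : ℝ}

theorem vt (hK : IsNormalForm K b l r q) : K (b 1) (b 0) = (-(l / 2)) • b 1 := by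
  rw [hK.symm, hK.tv]

theorem wt (hK : IsNormalForm K b l r q) : K (b 2) (b 0) = (-(l / 2)) • b 2 := by
  rw [hK.symm, hK.tw]

theorem wv (hK : IsNormalForm K b l r q) : K (b 2) (b 1) = q • b 1 - r • b 2 := by
  rw [hK.symm, hK.vw]

end IsNormalForm

theorem IsLorentzONB.isNormalForm (hb : IsLorentzONB h b) {K : E →ₗ[ℝ] E →ₗ[ℝ] E} {κ : ℝ}
    (hsymm : ∀ X Y Z, h (K X Y) Z = h (K Y X) Z)
    (hsymm' : ∀ X Y Z, h (K X Y) Z = h (K X Z) Y)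
    (hvtt : ∀ i, i ≠ 0 → h (K (b 0) (b 0)) (b i) = 0)
    (htvv : ∀ i j, i ≠ 0 → j ≠ 0 → h (K (b 0) (b i)) (b j) = κ * h (b i) (b j))
    (htrace : ∀ X, ∑ i, b.repr (K X (b i)) i = 0) :
    IsNormalForm K b (-(2 * κ)) (h (K (b 1) (b 1)) (b 1)) (h (K (b 1) (b 1)) (b 2)) := by
  have hb' : ∀ i j, h (b i) (b j) = Matrix.diagonal ![(-1 : ℝ), 1, 1] i j := hb
  have hC001 : h (K (b 0) (b 0)) (b 1) = 0 := hvtt 1 (by decide)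
  have hC002 : h (K (b 0) (b 0)) (b 2) = 0 := hvtt 2 (by decide)
  have hC010 : h (K (b 0) (b 1)) (b 0) = 0 := by rw [hsymm', hC001]
  have hC020 : h (K (b 0) (b 2)) (b 0) = 0 := by rw [hsymm', hC002]
  have hC011 : h (K (b 0) (b 1)) (b 1) = κ := by simpa [hb'] using htvv 1 1
  have hC012 : h (K (b 0) (b 1)) (b 2) = 0 := by simpa [hb'] using htvv 1 2
  have hC021 : h (K (b 0) (b 2)) (b 1) = 0 := by simpa [hb'] using htvv 2 1
  have hC022 : h (K (b 0) (b 2)) (b 2) = κ := by simpa [hb'] using htvv 2 2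
  have htrace' : ∀ X, -h (K X (b 0)) (b 0) + h (K X (b 1)) (b 1) + h (K X (b 2)) (b 2) = 0 := by
    intro X
    rw [← htrace X, Fin.sum_univ_three, hb.repr_zero, hb.repr_one, hb.repr_two]
  have hC000 : h (K (b 0) (b 0)) (b 0) = 2 * κ := by linarith [htrace' (b 0)]
  have hC110 : h (K (b 1) (b 1)) (b 0) = κ := by rw [hsymm', hsymm, hC011]
  have hC120 : h (K (b 1) (b 2)) (b 0) = 0 := by rw [hsymm', hsymm, hC012]
  have hC220 : h (K (b 2) (b 2)) (b 0) = κ := by rw [hsymm', hsymm, hC022]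
  have hC121 : h (K (b 1) (b 2)) (b 1) = h (K (b 1) (b 1)) (b 2) := hsymm' _ _ _
  have hC122 : h (K (b 1) (b 2)) (b 2) = -h (K (b 1) (b 1)) (b 1) := by
    linarith [htrace' (b 1), hsymm (b 1) (b 0) (b 0)]
  have hC221 : h (K (b 2) (b 2)) (b 1) = -h (K (b 1) (b 1)) (b 1) := by rw [hsymm', hsymm, hC122]
  have hC222 : h (K (b 2) (b 2)) (b 2) = -h (K (b 1) (b 1)) (b 2) := by
    linarith [htrace' (b 2), hsymm (b 2) (b 0) (b 0), hsymm (b 2) (b 1) (b 1)]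
  have hκ : -(-(2 * κ) / 2) = κ := by ring
  constructor
  · exact fun X Y => hb.ext fun i => hsymm X Y (b i)
  all_goals
    refine hb.ext fun i => ?_
    fin_cases i <;>
      simp [hb', hκ, hC000, hC001, hC002, hC010, hC011, hC012, hC020, hC021, hC022, hC110,
        hC120, hC121, hC122, hC220, hC221, hC222]

theorem toLin_rotationMatrix_zero (b : Module.Basis (Fin 3) ℝ E) (s : ℝ) :
    Matrix.toLin b b (rotationMatrix s) (b 0) = b 0 := by
  simp [Matrix.toLin_self, Fin.sum_univ_three, rotationMatrix]

theorem toLin_rotationMatrix_one (b : Module.Basis (Fin 3) ℝ E) (s : ℝ) :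
    Matrix.toLin b b (rotationMatrix s) (b 1) = Real.cos s • b 1 + Real.sin s • b 2 := by
  simp [Matrix.toLin_self, Fin.sum_univ_three, rotationMatrix]

theorem toLin_rotationMatrix_two (b : Module.Basis (Fin 3) ℝ E) (s : ℝ) :
    Matrix.toLin b b (rotationMatrix s) (b 2) = (-Real.sin s) • b 1 + Real.cos s • b 2 := by
  simp [Matrix.toLin_self, Fin.sum_univ_three, rotationMatrix]

theorem IsLorentzONB.apply_toLin_rotationMatrix (hb : IsLorentzONB h b) (s : ℝ) (X Y : E) :
    h (Matrix.toLin b b (rotationMatrix s) X) (Matrix.toLin b b (rotationMatrix s) Y) = h X Y := by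
  have hrepr : ∀ Z, b.repr (Matrix.toLin b b (rotationMatrix s) Z) =
      (rotationMatrix s).mulVec (b.repr Z) := fun Z => by
    rw [← LinearMap.toMatrix_mulVec_repr b b, LinearMap.toMatrix_toLin]
  rw [hb.apply_apply, hb.apply_apply X Y, hrepr, hrepr]
  simp only [rotationMatrix, Matrix.mulVec, dotProduct, Fin.sum_univ_three, Matrix.of_apply,
    Matrix.cons_val]
  linear_combination (b.repr X 1 * b.repr Y 1 + b.repr X 2 * b.repr Y 2) *
    Real.sin_sq_add_cos_sq s

theorem sq_cos_two_mul_sub_cos_add_sq_sin_two_mul_add_sin (s : ℝ) :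
    (Real.cos (2 * s) - Real.cos s) ^ 2 + (Real.sin (2 * s) + Real.sin s) ^ 2 =
      2 - 2 * Real.cos (3 * s) := by
  rw [show 3 * s = 2 * s + s by ring, Real.cos_add]
  linear_combination Real.sin_sq_add_cos_sq (2 * s) + Real.sin_sq_add_cos_sq s

/-- The two equations are the invariance under the rotation by `s` of the cubic form
`Re ((r - i q) (x + i y)³)`, whose squares add up to `(r² + q²) |e^{2is} - e^{-is}|²`. -/
theorem rotation_invariance_iff (r q s : ℝ) :
    (r * (Real.cos (2 * s) - Real.cos s) + q * (Real.sin (2 * s) + Real.sin s) = 0 ∧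
        q * (Real.cos (2 * s) - Real.cos s) - r * (Real.sin (2 * s) + Real.sin s) = 0) ↔
      (r = 0 ∧ q = 0) ∨ Real.cos (3 * s) = 1 := by
  have sq_add_sq_eq_zero : ∀ x y : ℝ, x ^ 2 + y ^ 2 = 0 ↔ x = 0 ∧ y = 0 := fun x y => by
    rw [add_eq_zero_iff_of_nonneg (sq_nonneg x) (sq_nonneg y), sq_eq_zero_iff, sq_eq_zero_iff]
  rw [← sq_add_sq_eq_zero, ← sq_add_sq_eq_zero r q, show (Real.cos (3 * s) = 1) ↔
    2 - 2 * Real.cos (3 * s) = 0 by constructor <;> intro h <;> linarith, ← mul_eq_zero,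
    ← sq_cos_two_mul_sub_cos_add_sq_sin_two_mul_add_sin]
  ring_nf

namespace IsNormalForm

variable {K : E →ₗ[ℝ] E →ₗ[ℝ] E} {l r q : ℝ}

theorem rotation_preserves_iff (hK : IsNormalForm K b l r q) (s : ℝ) :
    (∀ X Y, K (Matrix.toLin b b (rotationMatrix s) X) (Matrix.toLin b b (rotationMatrix s) Y) =
      Matrix.toLin b b (rotationMatrix s) (K X Y)) ↔
      (r = 0 ∧ q = 0) ∨ Real.cos (3 * s) = 1 := by
  have hsq := Real.sin_sq_add_cos_sq s
  have L0 := toLin_rotationMatrix_zero b s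
  have L1 := toLin_rotationMatrix_one b s
  have L2 := toLin_rotationMatrix_two b s
  rw [← rotation_invariance_iff, Real.cos_two_mul', Real.sin_two_mul]
  set L := Matrix.toLin b b (rotationMatrix s)
  constructor
  · intro hL
    have hvv := hL (b 1) (b 1)
    simp only [map_add, map_smul, L0, L1, L2, LinearMap.add_apply, LinearMap.smul_apply,
      hK.vv, hK.vw, hK.wv, hK.ww] at hvv
    have hv : b.repr _ 1 = b.repr _ 1 := congrArg (b.repr · 1) hvv
    have hw : b.repr _ 2 = b.repr _ 2 := congrArg (b.repr · 2) hvv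
    simp only [map_add, map_sub, map_neg, map_smul, smul_add, smul_neg, neg_smul,
      Module.Basis.repr_self, Finsupp.smul_single, Finsupp.coe_add, Finsupp.coe_sub,
      Finsupp.coe_neg, Finsupp.coe_smul, Pi.add_apply, Pi.sub_apply, Pi.neg_apply, Pi.smul_apply,
      smul_eq_mul, Finsupp.single_eq_same, Finsupp.single_eq_of_ne, ne_eq, one_ne_zero,
      Fin.reduceEq, not_false_eq_true] at hv hw
    exact ⟨by linear_combination hv, by linear_combination hw⟩
  · rintro ⟨hv, hw⟩
    have hext : K.compl₁₂ L L = K.compr₂ L := by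
      refine b.ext fun i => b.ext fun j => ?_
      rw [LinearMap.compl₁₂_apply, LinearMap.compr₂_apply]
      fin_cases i <;> fin_cases j <;>
        simp only [Fin.zero_eta, Fin.mk_one, Fin.reduceFinMk, map_add, map_sub, map_smul, L0, L1,
          L2, LinearMap.add_apply, LinearMap.smul_apply, hK.tt, hK.tv, hK.tw, hK.vt,
          hK.wt, hK.vv, hK.vw, hK.wv, hK.ww]
      · module
      · module
      · module
      · linear_combination (norm := module) hv • b 1 + hw • b 2 + ((l / 2) • hsq) • b 0
      · linear_combination (norm := module) hw • b 1 - hv • b 2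
      · module
      · linear_combination (norm := module) hw • b 1 - hv • b 2
      · linear_combination (norm := module) -(hv • b 1) - hw • b 2 + ((l / 2) • hsq) • b 0
    exact fun X Y => congrArg (fun B => B X Y) hext

/-- For `L t = x t + u v + w w` the `t`-components of `K(L t, L t) = L K(t, t)` and of
`h(L t, L t) = -1` give `x = x² + (u² + w²)/2` and `x² = 1 + u² + w²`, hence `L t = t`. -/
theorem map_timelike_eq_of_preserves (hb : IsLorentzONB h b) (hK : IsNormalForm K b l r q)
    (hl : l ≠ 0) {L : E →ₗ[ℝ] E} (hL : ∀ X Y, h (L X) (L Y) = h X Y)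
    (hLK : ∀ X Y, K (L X) (L Y) = L (K X Y)) : L (b 0) = b 0 := by
  have hLt := sum_repr_three b (L (b 0))
  have hnorm := hL (b 0) (b 0)
  rw [hb.apply_apply, hb.apply_apply] at hnorm
  set x := b.repr (L (b 0)) 0 with hx_def
  set u := b.repr (L (b 0)) 1
  set w := b.repr (L (b 0)) 2
  have hKt : l * x = l * (x ^ 2 + (u ^ 2 + w ^ 2) / 2) := by
    calc l * x = b.repr (K (L (b 0)) (L (b 0))) 0 := by simp [hLK, hK.tt, hx_def]
      _ = l * (x ^ 2 + (u ^ 2 + w ^ 2) / 2) := by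
        rw [← hLt]
        simp only [map_add, map_sub, map_neg, map_smul, smul_add, smul_neg, neg_smul,
          LinearMap.add_apply, LinearMap.smul_apply, hK.tt, hK.tv, hK.tw, hK.vt, hK.wt, hK.vv,
          hK.vw, hK.wv, hK.ww, Module.Basis.repr_self, Finsupp.smul_single, Finsupp.coe_add,
          Finsupp.coe_sub, Finsupp.coe_neg, Finsupp.coe_smul, Pi.add_apply, Pi.sub_apply,
          Pi.neg_apply, Pi.smul_apply, smul_eq_mul, Finsupp.single_eq_same,
          Finsupp.single_eq_of_ne, ne_eq, zero_ne_one, Fin.reduceEq, not_false_eq_true]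
        ring
  have hx_eq : x = x ^ 2 + (u ^ 2 + w ^ 2) / 2 := mul_left_cancel₀ hl hKt
  have hx_sq : x ^ 2 = 1 + u ^ 2 + w ^ 2 := by
    simp only [Module.Basis.repr_self, Finsupp.single_eq_same, Finsupp.single_eq_of_ne, ne_eq,
      one_ne_zero, Fin.reduceEq, not_false_eq_true, mul_one, mul_zero, add_zero] at hnorm
    linarith
  have hx : x = 1 := by nlinarith [sq_nonneg u, sq_nonneg w]
  rw [hx] at hx_sq
  have hu : u = 0 := by nlinarith [sq_nonneg u, sq_nonneg w]
  have hw : w = 0 := by nlinarith [sq_nonneg u, sq_nonneg w]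
  rw [← hLt, hx, hu, hw]
  simp

end IsNormalForm

theorem mem_groupSO2 {A : Matrix.SpecialLinearGroup (Fin 3) ℝ} :
    A ∈ groupSO2 ↔ ∃ s, A.1 = rotationMatrix s := by
  constructor
  · rintro ⟨s, rfl⟩
    exact ⟨s.toAdd, rfl⟩
  · rintro ⟨s, hs⟩
    exact ⟨Multiplicative.ofAdd s, Subtype.ext hs.symm⟩

theorem mem_groupZ3 {A : Matrix.SpecialLinearGroup (Fin 3) ℝ} :
    A ∈ groupZ3 ↔ ∃ s, A.1 = rotationMatrix s ∧ Real.cos (3 * s) = 1 := by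
  have hpow : ∀ k : ℤ, rotation (Multiplicative.ofAdd (2 * Real.pi / 3)) ^ k =
      rotation (Multiplicative.ofAdd (k * (2 * Real.pi / 3))) := fun k => by
    rw [← map_zpow, ← ofAdd_zsmul, zsmul_eq_mul]
  rw [groupZ3, Subgroup.mem_zpowers_iff]
  simp only [hpow]
  constructor
  · rintro ⟨k, rfl⟩
    refine ⟨k * (2 * Real.pi / 3), rfl, ?_⟩
    rw [show 3 * ((k : ℝ) * (2 * Real.pi / 3)) = k * (2 * Real.pi) by ring]
    exact Real.cos_int_mul_two_pi k
  · rintro ⟨s, hs, hcos⟩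
    obtain ⟨k, hk⟩ := (Real.cos_eq_one_iff _).1 hcos
    have hks : (k : ℝ) * (2 * Real.pi / 3) = s := by linarith
    exact ⟨k, Subtype.ext (by rw [hs, hks]; rfl)⟩

theorem groupZ3_le_groupSO2 : groupZ3 ≤ groupSO2 := fun _ hA =>
  let ⟨s, hs, _⟩ := mem_groupZ3.1 hA
  mem_groupSO2.2 ⟨s, hs⟩

theorem exists_cos_sin_eq {x y : ℝ} (h : x ^ 2 + y ^ 2 = 1) :
    ∃ s, x = Real.cos s ∧ y = Real.sin s := by
  obtain ⟨s, hs⟩ := (Complex.norm_eq_one_iff ⟨x, y⟩).1 <| by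
    rw [← sq_eq_sq₀ (norm_nonneg _) zero_le_one, Complex.sq_norm, Complex.normSq_mk]
    linarith
  exact ⟨s, by simpa [Complex.exp_ofReal_mul_I_re] using (congrArg Complex.re hs).symm,
    by simpa [Complex.exp_ofReal_mul_I_im] using (congrArg Complex.im hs).symm⟩

theorem IsLorentzONB.mem_groupSO2_of_map_timelike_eq (hb : IsLorentzONB h b)
    {A : Matrix.SpecialLinearGroup (Fin 3) ℝ}
    (hA : ∀ X Y, h (Matrix.toLin b b A.1 X) (Matrix.toLin b b A.1 Y) = h X Y)
    (hA0 : Matrix.toLin b b A.1 (b 0) = b 0) : A ∈ groupSO2 := by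
  have hrepr : ∀ i j, b.repr (Matrix.toLin b b A.1 (b j)) i = A.1 i j := fun i j => by
    rw [Matrix.toLin_self]; simp [Finsupp.single_apply]
  have h00 : A.1 0 0 = 1 := by rw [← hrepr, hA0]; simp
  have h10 : A.1 1 0 = 0 := by rw [← hrepr, hA0]; simp
  have h20 : A.1 2 0 = 0 := by rw [← hrepr, hA0]; simp
  have hrow : ∀ i j, Matrix.diagonal ![(-1 : ℝ), 1, 1] i j =
      -(A.1 0 i * A.1 0 j) + A.1 1 i * A.1 1 j + A.1 2 i * A.1 2 j := fun i j => by
    rw [← hb, ← hA, hb.apply_apply]; simp only [hrepr]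
  have h01 : A.1 0 1 = 0 := by simpa [h00, h10, h20] using hrow 0 1
  have h02 : A.1 0 2 = 0 := by simpa [h00, h10, h20] using hrow 0 2
  have hvv : 1 = A.1 1 1 * A.1 1 1 + A.1 2 1 * A.1 2 1 := by simpa [h01] using hrow 1 1
  have hvw : 0 = A.1 1 1 * A.1 1 2 + A.1 2 1 * A.1 2 2 := by simpa [h01, h02] using hrow 1 2
  have hdet := A.2
  rw [Matrix.det_fin_three] at hdet
  simp only [h00, h10, h20, h01, h02] at hdet
  have h22 : A.1 2 2 = A.1 1 1 := by
    linear_combination A.1 1 1 * hdet + A.1 2 2 * hvv - A.1 2 1 * hvw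
  have h12 : A.1 1 2 = -A.1 2 1 := by
    linear_combination -A.1 2 1 * hdet + A.1 1 2 * hvv - A.1 1 1 * hvw
  obtain ⟨s, hcos, hsin⟩ := exists_cos_sin_eq (x := A.1 1 1) (y := A.1 2 1) (by
    linear_combination -hvv)
  refine mem_groupSO2.2 ⟨s, ?_⟩
  ext i j
  fin_cases i <;> fin_cases j <;>
    simp [rotationMatrix, h00, h10, h20, h01, h02, h22, h12, hcos, hsin]

/-- The matrices of determinant one, with respect to the basis `b`, that preserve the bilinear form
`h`, the bilinear map `K` and the endomorphism `S`. -/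
def tensorSymmetries (h : E →L[ℝ] E →L[ℝ] ℝ) (K : E →ₗ[ℝ] E →ₗ[ℝ] E) (S : E → E)
    (b : Module.Basis (Fin 3) ℝ E) : Set (Matrix.SpecialLinearGroup (Fin 3) ℝ) :=
  {A | (∀ X Y, h (Matrix.toLin b b A.1 X) (Matrix.toLin b b A.1 Y) = h X Y) ∧
    (∀ X Y, K (Matrix.toLin b b A.1 X) (Matrix.toLin b b A.1 Y) =
      Matrix.toLin b b A.1 (K X Y)) ∧
    ∀ X, S (Matrix.toLin b b A.1 X) = Matrix.toLin b b A.1 (S X)}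

namespace IsNormalForm

variable {K : E →ₗ[ℝ] E →ₗ[ℝ] E} {l r q : ℝ} {S : E → E} {c : ℝ}

theorem rotation_mem_tensorSymmetries_iff (hb : IsLorentzONB h b) (hK : IsNormalForm K b l r q)
    (hS : ∀ X, S X = c • X) {A : Matrix.SpecialLinearGroup (Fin 3) ℝ} {s : ℝ}
    (hA : A.1 = rotationMatrix s) :
    A ∈ tensorSymmetries h K S b ↔ (r = 0 ∧ q = 0) ∨ Real.cos (3 * s) = 1 := by
  rw [← hK.rotation_preserves_iff s, tensorSymmetries, Set.mem_ofPred_eq, hA]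
  refine ⟨fun H => H.2.1, fun H => ⟨hb.apply_toLin_rotationMatrix s, H, fun X => ?_⟩⟩
  rw [hS, hS, map_smul]

theorem tensorSymmetries_inter_groupSO2 (hb : IsLorentzONB h b) (hK : IsNormalForm K b l r q)
    (hS : ∀ X, S X = c • X) :
    tensorSymmetries h K S b ∩ groupSO2 = groupZ3 ∨
      tensorSymmetries h K S b ∩ groupSO2 = groupSO2 := by
  by_cases hrq : r = 0 ∧ q = 0
  · right
    refine Set.inter_eq_right.2 fun A hA => ?_
    obtain ⟨s, hs⟩ := mem_groupSO2.1 hA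
    exact (hK.rotation_mem_tensorSymmetries_iff hb hS hs).2 (Or.inl hrq)
  · left
    refine Set.Subset.antisymm ?_ fun A hA => ⟨?_, groupZ3_le_groupSO2 hA⟩
    · rintro A ⟨hA, hA'⟩
      obtain ⟨s, hs⟩ := mem_groupSO2.1 hA'
      exact mem_groupZ3.2
        ⟨s, hs, ((hK.rotation_mem_tensorSymmetries_iff hb hS hs).1 hA).resolve_left hrq⟩
    · obtain ⟨s, hs, hcos⟩ := mem_groupZ3.1 hA
      exact (hK.rotation_mem_tensorSymmetries_iff hb hS hs).2 (Or.inr hcos)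

theorem tensorSymmetries_subset_groupSO2 (hb : IsLorentzONB h b) (hK : IsNormalForm K b l r q)
    (ht : K (b 0) (b 0) ≠ 0) : tensorSymmetries h K S b ⊆ groupSO2 := by
  rintro A ⟨hA, hAK, -⟩
  have hl : l ≠ 0 := fun hl => ht (by rw [hK.tt, hl, zero_smul])
  exact hb.mem_groupSO2_of_map_timelike_eq hA (hK.map_timelike_eq_of_preserves hb hl hA hAK)

end IsNormalForm

end Lorentz

section WarpedForm

variable {V : Type*} [NormedAddCommGroup V] [NormedSpace ℝ V] {n : ℕ}
  {h : ℝ × V →L[ℝ] ℝ × V →L[ℝ] ℝ} {g : V →L[ℝ] V →L[ℝ] ℝ} {a r : ℝ}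

/-- The bilinear form `h` on `ℝ × V` is the orthogonal sum `a dt² + r g`, the pointwise form of a
warped product metric. -/
def IsWarpedForm (h : ℝ × V →L[ℝ] ℝ × V →L[ℝ] ℝ) (a r : ℝ) (g : V →L[ℝ] V →L[ℝ] ℝ) : Prop :=
  ∀ s s' X X', h (s, X) (s', X') = a * (s * s') + r * g X X'

/-- The basis `∂ₜ, e₀, …, eₙ₋₁` of `ℝ × V`. -/
noncomputable def warpBasis (e : Module.Basis (Fin n) ℝ V) :
    Module.Basis (Fin (n + 1)) ℝ (ℝ × V) :=
  ((Module.Basis.singleton Unit ℝ).prod e).reindex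
    ((Equiv.sumComm _ _).trans ((finSuccEquiv n).trans (Equiv.optionEquivSumPUnit _)).symm)

theorem warpBasis_zero (e : Module.Basis (Fin n) ℝ V) : warpBasis e 0 = (1, 0) := by
  simp [warpBasis, Module.Basis.prod_apply]

theorem warpBasis_succ (e : Module.Basis (Fin n) ℝ V) (i : Fin n) :
    warpBasis e i.succ = (0, e i) := by
  simp [warpBasis, Module.Basis.prod_apply]

theorem exists_orthonormal_basis (hV : Module.finrank ℝ V = n) [FiniteDimensional ℝ V]
    (hsymm : ∀ X Y, g X Y = g Y X) (hpos : ∀ X, X ≠ 0 → 0 < g X X) :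
    ∃ e : Module.Basis (Fin n) ℝ V, ∀ i j, g (e i) (e j) = if i = j then 1 else 0 := by
  obtain ⟨v, hv⟩ := LinearMap.BilinForm.exists_orthogonal_basis (B := g.toLinearMap₁₂)
    ⟨fun X Y => hsymm X Y⟩
  let v' := v.reindex (finCongr hV)
  have hpos' : ∀ i, 0 < g (v' i) (v' i) := fun i => hpos _ (v'.ne_zero i)
  have horth : ∀ i j, i ≠ j → g (v' i) (v' j) = 0 := fun i j hij => by
    simpa [v'] using hv (i := (finCongr hV).symm i) (j := (finCongr hV).symm j) (by simpa using hij)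
  have hunit : ∀ i, IsUnit (√(g (v' i) (v' i)))⁻¹ := fun i =>
    isUnit_iff_ne_zero.2 (inv_ne_zero (Real.sqrt_pos.2 (hpos' i)).ne')
  refine ⟨v'.isUnitSMul hunit, fun i j => ?_⟩
  simp only [Module.Basis.isUnitSMul_apply, map_smul, smul_apply, smul_eq_mul]
  split_ifs with hij
  · subst hij
    rw [← mul_assoc, ← mul_inv, Real.mul_self_sqrt (hpos' i).le, inv_mul_cancel₀ (hpos' i).ne']
  · rw [horth i j hij, mul_zero, mul_zero]

namespace IsWarpedForm

theorem ne_zero_left (H : IsWarpedForm h a r g) (hnd : ∀ x, (∀ y, h x y = 0) → x = 0) :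
    a ≠ 0 := fun ha =>
  one_ne_zero (congrArg Prod.fst (hnd (1, 0) fun y => by rw [H 1 y.1 0 y.2, ha]; simp))

theorem ne_zero_right [Nontrivial V] (H : IsWarpedForm h a r g)
    (hnd : ∀ x, (∀ y, h x y = 0) → x = 0) : r ≠ 0 := fun hr => by
  obtain ⟨X, hX⟩ := exists_ne (0 : V)
  exact hX (congrArg Prod.snd (hnd (0, X) fun y => by rw [H 0 y.1 X y.2, hr]; simp))

theorem nondegenerate (H : IsWarpedForm h a r g) (ha : a ≠ 0) (hr : r ≠ 0)
    (hnd : ∀ X, (∀ Y, g X Y = 0) → X = 0) (x : ℝ × V) (hx : ∀ y, h x y = 0) : x = 0 := by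
  refine Prod.ext ?_ (hnd x.2 fun Y => ?_)
  · simpa [H x.1 1 x.2 0, ha] using hx (1, 0)
  · simpa [H x.1 0 x.2 Y, hr] using hx (0, Y)

theorem det_gramMatrix_warpBasis (H : IsWarpedForm h a r g) (e : Module.Basis (Fin n) ℝ V) :
    (gramMatrix h (warpBasis e)).det = a * r ^ n * (gramMatrix g e).det := by
  have hminor : (gramMatrix h (warpBasis e)).submatrix Fin.succ Fin.succ =
      r • gramMatrix g e := by
    ext i j
    simp [gramMatrix, warpBasis_succ, H 0 0]
  rw [Matrix.det_succ_column_zero, Fin.sum_univ_succ, Fin.succAbove_zero, hminor, Matrix.det_smul]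
  simp [gramMatrix, warpBasis_zero, warpBasis_succ, H 1 1, H 0 1, mul_assoc]

theorem neg_and_pos (H : IsWarpedForm h a r g)
    (hV : 1 < Module.finrank ℝ V) (hpos : ∀ X, X ≠ 0 → 0 < g X X)
    {b : Module.Basis (Fin 3) ℝ (ℝ × V)} (hb : IsLorentzONB h b) : a < 0 ∧ 0 < r := by
  have := Module.finite_of_finrank_pos (R := ℝ) (M := V) (by omega)
  have hr : 0 < r := by
    -- The spacelike plane spanned by `b 1` and `b 2` meets `0 × V` in a nonzero vector.
    obtain ⟨X, hX, hX0⟩ := Submodule.exists_mem_ne_zero_of_ne_bot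
      (LinearMap.ker_ne_bot_of_finrank_lt (f := (b.coord 0).comp (LinearMap.inr ℝ ℝ V)) (by simpa))
    have hX : b.repr (0, X) 0 = 0 := hX
    have happly : r * g X X = b.repr (0, X) 1 ^ 2 + b.repr (0, X) 2 ^ 2 := by
      linear_combination hb.apply_apply (0, X) (0, X) - H 0 0 X X - b.repr (0, X) 0 * hX
    refine pos_of_mul_pos_left (lt_of_not_ge fun hle => hX0 ?_) (hpos X hX0).le
    have h₁ : b.repr (0, X) 1 = 0 := by nlinarith [sq_nonneg (b.repr (0, X) 2)]
    have h₂ : b.repr (0, X) 2 = 0 := by nlinarith [sq_nonneg (b.repr (0, X) 1)]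
    have hzero := sum_repr_three b (0, X)
    rw [hX, h₁, h₂] at hzero
    simpa using (congrArg Prod.snd hzero).symm
  refine ⟨?_, hr⟩
  have h00 : a * ((b 0).1 * (b 0).1) + r * g (b 0).2 (b 0).2 = -1 := by
    rw [← H]; simpa using hb 0 0
  have hg : 0 ≤ g (b 0).2 (b 0).2 := by
    by_cases hX : (b 0).2 = 0
    · simp [hX]
    · exact (hpos _ hX).le
  by_contra! ha
  nlinarith [mul_nonneg ha (mul_self_nonneg (b 0).1), mul_nonneg hr.le hg]

theorem exists_isLorentzONB (H : IsWarpedForm h a r g)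
    (hV : Module.finrank ℝ V = 2) (hsymm : ∀ X Y, g X Y = g Y X)
    (hpos : ∀ X, X ≠ 0 → 0 < g X X) (ha : a < 0) (hr : 0 < r) :
    ∃ b : Module.Basis (Fin 3) ℝ (ℝ × V), IsLorentzONB h b ∧ (b 0).2 = 0 ∧
      ∀ i, i ≠ 0 → (b i).1 = 0 := by
  have := Module.finite_of_finrank_pos (R := ℝ) (M := V) (by omega)
  obtain ⟨e, he⟩ := exists_orthonormal_basis hV hsymm hpos
  have ha' : √(-a) ≠ 0 := (Real.sqrt_pos.2 (by linarith)).ne'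
  have hr' : √r ≠ 0 := (Real.sqrt_pos.2 hr).ne'
  let w : Fin 3 → ℝ := Fin.cons (√(-a))⁻¹ fun _ => (√r)⁻¹
  have hw : ∀ i, IsUnit (w i) := Fin.cases (by simpa [w] using ha') fun i => by simpa [w] using hr'
  let b := (warpBasis e).isUnitSMul hw
  have hb₀ : b 0 = ((√(-a))⁻¹, 0) := by simp [b, w, Module.Basis.isUnitSMul_apply, warpBasis_zero]
  have hb : ∀ i : Fin 2, b i.succ = (0, (√r)⁻¹ • e i) := fun i => by
    simp [b, w, Module.Basis.isUnitSMul_apply, warpBasis_succ]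
  have hea : a * ((√(-a))⁻¹ * (√(-a))⁻¹) = -1 := by
    field_simp
    rw [Real.sq_sqrt (by linarith), neg_neg]
  have her : r * ((√r)⁻¹ * (√r)⁻¹) = 1 := by
    field_simp
    rw [Real.sq_sqrt hr.le]
  refine ⟨b, ?_, by rw [hb₀], Fin.cases (fun h => (h rfl).elim) fun i _ => by rw [hb]⟩
  refine Fin.cases (Fin.cases ?_ fun j => ?_) fun i => Fin.cases ?_ fun j => ?_
  · simpa [hb₀, H _ _ _ _] using hea
  · simp [hb₀, hb, H _ _ _ _, (Fin.succ_ne_zero j).symm]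
  · simp [hb₀, hb, H _ _ _ _]
  · rw [hb, hb, H, map_smul, map_smul, smul_apply, he]
    fin_cases i <;> fin_cases j <;> simp [her]

end IsWarpedForm

end WarpedForm

section Warp

/-- The inclusion `v ↦ (0, v)` of `ℝ³` into `ℝ⁴`. -/
noncomputable def consZero : (Fin 3 → ℝ) →L[ℝ] (Fin 4 → ℝ) :=
  ContinuousLinearMap.pi (Fin.cons 0 fun i => ContinuousLinearMap.proj i)

/-- The vector `(1, 0)` of `ℝ⁴ = ℝ × ℝ³`, which spans the axis of the warped hypersurfaces. -/
def axis : Fin 4 → ℝ := Matrix.vecCons 1 0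

theorem smul_axis_add_consZero (a : ℝ) (v : Fin 3 → ℝ) :
    a • axis + consZero v = Matrix.vecCons a v := by
  ext i
  induction i using Fin.cases <;> simp [axis, consZero]

variable {V : Type*} [NormedAddCommGroup V] [NormedSpace ℝ V]
  {γ₁ γ₂ : ℝ → ℝ} {ψ : V → Fin 3 → ℝ} {t : ℝ} {u : V}

theorem warp_eq {N : Type*} (γ₁ γ₂ : ℝ → ℝ) (φ : N → Fin 3 → ℝ) :
    warp γ₁ γ₂ φ = fun x => γ₁ x.1 • axis + γ₂ x.1 • consZero (φ x.2) := by
  ext1 x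
  rw [← map_smul, smul_axis_add_consZero, warp]

theorem hasFDerivAt_warp (h₁ : DifferentiableAt ℝ γ₁ t) (h₂ : DifferentiableAt ℝ γ₂ t)
    (hψ : DifferentiableAt ℝ ψ u) :
    HasFDerivAt (warp γ₁ γ₂ ψ)
      (((ContinuousLinearMap.fst ℝ ℝ V).smulRight
          (deriv γ₁ t • axis + deriv γ₂ t • consZero (ψ u)) +
        γ₂ t • consZero.comp ((fderiv ℝ ψ u).comp (ContinuousLinearMap.snd ℝ ℝ V))) :
          ℝ × V →L[ℝ] Fin 4 → ℝ) (t, u) := by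
  have d₁ : HasFDerivAt (fun x : ℝ × V => γ₁ x.1) _ (t, u) :=
    h₁.hasDerivAt.hasFDerivAt.comp (t, u) hasFDerivAt_fst
  have d₂ : HasFDerivAt (fun x : ℝ × V => γ₂ x.1) _ (t, u) :=
    h₂.hasDerivAt.hasFDerivAt.comp (t, u) hasFDerivAt_fst
  have d₃ : HasFDerivAt (fun x : ℝ × V => consZero (ψ x.2)) _ (t, u) :=
    consZero.hasFDerivAt.comp (t, u) (hψ.hasFDerivAt.comp (t, u) hasFDerivAt_snd)
  rw [warp_eq]
  refine ((d₁.smul_const axis).add (d₂.smul d₃)).congr_fderiv ?_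
  ext x i <;> simp

theorem fderiv_warp_apply (h₁ : DifferentiableAt ℝ γ₁ t) (h₂ : DifferentiableAt ℝ γ₂ t)
    (hψ : DifferentiableAt ℝ ψ u) (s : ℝ) (X : V) :
    fderiv ℝ (warp γ₁ γ₂ ψ) (t, u) (s, X) = (deriv γ₁ t * s) • axis +
      consZero ((deriv γ₂ t * s) • ψ u + γ₂ t • fderiv ℝ ψ u X) := by
  simp only [(hasFDerivAt_warp h₁ h₂ hψ).fderiv, add_apply, smul_apply,
    ContinuousLinearMap.smulRight_apply, ContinuousLinearMap.comp_apply,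
    ContinuousLinearMap.coe_fst', ContinuousLinearMap.coe_snd', map_add, map_smul]
  module

theorem eventually_differentiableAt {A B : Type*} [NormedAddCommGroup A] [NormedSpace ℝ A]
    [NormedAddCommGroup B] [NormedSpace ℝ B] {g : A → B} {a : A} (hg : ContDiffAt ℝ ∞ g a) :
    ∀ᶠ z in 𝓝 a, DifferentiableAt ℝ g z :=
  ((hg.of_le (by simp : (1 : WithTop ℕ∞) ≤ ∞)).eventually (by simp)).mono
    fun _ hz => hz.differentiableAt (by simp)

theorem contDiffAt_deriv {γ : ℝ → ℝ} (h : ContDiffAt ℝ ∞ γ t) : ContDiffAt ℝ ∞ (deriv γ) t :=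
  (contDiffAt_fderiv_of_contDiffAt_infty h).clm_apply contDiffAt_const

theorem contDiffAt_warp (h₁ : ContDiffAt ℝ ∞ γ₁ t) (h₂ : ContDiffAt ℝ ∞ γ₂ t)
    (hψ : ContDiffAt ℝ ∞ ψ u) : ContDiffAt ℝ ∞ (warp γ₁ γ₂ ψ) (t, u) := by
  rw [warp_eq]
  exact ((h₁.comp (t, u) contDiffAt_fst).smul contDiffAt_const).add
    ((h₂.comp (t, u) contDiffAt_fst).smul
      (consZero.contDiff.contDiffAt.comp (t, u) (hψ.comp (t, u) contDiffAt_snd)))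

theorem fderiv_fderiv_warp_apply (h₁ : ContDiffAt ℝ ∞ γ₁ t) (h₂ : ContDiffAt ℝ ∞ γ₂ t)
    (hψ : ContDiffAt ℝ ∞ ψ u) (s r : ℝ) (X Y : V) :
    fderiv ℝ (fderiv ℝ (warp γ₁ γ₂ ψ)) (t, u) (s, X) (r, Y) =
      (deriv (deriv γ₁) t * s * r) • axis +
      consZero ((deriv (deriv γ₂) t * s * r) • ψ u + (deriv γ₂ t * r) • fderiv ℝ ψ u X +
        (deriv γ₂ t * s) • fderiv ℝ ψ u Y + γ₂ t • fderiv ℝ (fderiv ℝ ψ) u X Y) := by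
  have d₁ : DifferentiableAt ℝ (deriv γ₁) t := (contDiffAt_deriv h₁).differentiableAt (by simp)
  have d₂ : DifferentiableAt ℝ (deriv γ₂) t := (contDiffAt_deriv h₂).differentiableAt (by simp)
  have dY : HasFDerivAt (fun z => fderiv ℝ ψ z Y) ((fderiv ℝ (fderiv ℝ ψ) u).flip Y) u := by
    simpa using ((contDiffAt_fderiv_of_contDiffAt_infty hψ).differentiableAt
      (by simp)).hasFDerivAt.clm_apply (hasFDerivAt_const Y u)
  have dF := ((contDiffAt_fderiv_of_contDiffAt_infty (contDiffAt_warp h₁ h₂ hψ)).differentiableAt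
    (by simp)).hasFDerivAt.clm_apply (hasFDerivAt_const (r, Y) (t, u))
  -- The derivative of a warp in a fixed direction is a sum of two warps.
  have hsum : (fun z => fderiv ℝ (warp γ₁ γ₂ ψ) z (r, Y)) =ᶠ[𝓝 (t, u)] fun z =>
      warp (fun s => deriv γ₁ s * r) (fun s => deriv γ₂ s * r) ψ z +
        warp (fun _ => 0) γ₂ (fun z => fderiv ℝ ψ z Y) z := by
    filter_upwards [continuousAt_fst.eventually (eventually_differentiableAt h₁),
      continuousAt_fst.eventually (eventually_differentiableAt h₂),
      continuousAt_snd.eventually (eventually_differentiableAt hψ)] with z z₁ z₂ z₃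
    rw [fderiv_warp_apply z₁ z₂ z₃, map_add, map_smul, map_smul]
    simp only [warp_eq, zero_smul, zero_add, add_assoc]
  have k₁ := hasFDerivAt_warp (d₁.mul_const r) (d₂.mul_const r) (hψ.differentiableAt (by simp))
  have k₂ := hasFDerivAt_warp (differentiableAt_const (0 : ℝ)) (h₂.differentiableAt (by simp))
    dY.differentiableAt
  have happly := congrArg (· (s, X))
    (dF.unique ((k₁.add k₂).congr_of_eventuallyEq hsum))
  simp only [dY.fderiv, deriv_mul_const d₁, deriv_mul_const d₂, deriv_const, add_apply,
    smul_apply, ContinuousLinearMap.smulRight_apply, ContinuousLinearMap.comp_apply,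
    ContinuousLinearMap.coe_fst', ContinuousLinearMap.coe_snd', ContinuousLinearMap.flip_apply,
    zero_apply, map_zero, zero_add] at happly
  simp only [happly, map_add, map_smul]
  module

theorem det_frameMatrix_warp (h₁ : DifferentiableAt ℝ γ₁ t) (h₂ : DifferentiableAt ℝ γ₂ t)
    (hψ : DifferentiableAt ℝ ψ u) (e : Module.Basis (Fin 2) ℝ V) (a b : ℝ) :
    (frameMatrix (warp γ₁ γ₂ ψ) (fun _ => a • axis + b • consZero (ψ u)) (warpBasis e)
      (t, u)).det = (deriv γ₁ t * b - a * deriv γ₂ t) * γ₂ t ^ 2 *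
        (frameMatrix ψ (fun _ => ψ u) e u).det := by
  have hframe : frameMatrix (warp γ₁ γ₂ ψ) (fun _ => a • axis + b • consZero (ψ u)) (warpBasis e)
      (t, u) = Matrix.of ![Matrix.vecCons (deriv γ₁ t) (deriv γ₂ t • ψ u),
        Matrix.vecCons 0 (γ₂ t • fderiv ℝ ψ u (e 0)),
        Matrix.vecCons 0 (γ₂ t • fderiv ℝ ψ u (e 1)), Matrix.vecCons a (b • ψ u)] := by
    refine funext (Fin.lastCases ?_ (Fin.cases ?_ fun i => ?_))
    · rw [frameMatrix_last, ← map_smul, smul_axis_add_consZero]; rfl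
    · rw [frameMatrix_castSucc, warpBasis_zero, fderiv_warp_apply h₁ h₂ hψ,
        smul_axis_add_consZero, map_zero, smul_zero, add_zero, mul_one, mul_one]; rfl
    · rw [frameMatrix_castSucc, warpBasis_succ, fderiv_warp_apply h₁ h₂ hψ,
        smul_axis_add_consZero, mul_zero, mul_zero, zero_smul, zero_add]
      fin_cases i <;> rfl
  have hframe' : frameMatrix ψ (fun _ => ψ u) e u =
      Matrix.of ![fderiv ℝ ψ u (e 0), fderiv ℝ ψ u (e 1), ψ u] := by
    ext i j
    fin_cases i <;> rfl
  rw [hframe, hframe', Matrix.det_succ_column_zero, Fin.sum_univ_four]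
  simp only [Nat.succ_eq_add_one, Nat.reduceAdd, Matrix.submatrix, Fin.succAbove,
    Matrix.det_fin_three, Matrix.of_apply, Matrix.cons_val, Matrix.cons_val',
    Matrix.cons_val_zero, Matrix.cons_val_one, Matrix.cons_val_succ, Matrix.cons_val_fin_one,
    Pi.smul_apply, smul_eq_mul, Fin.coe_ofNat_eq_mod, Nat.zero_mod, Nat.one_mod, Nat.mod_succ,
    not_lt_zero, Fin.lt_one_iff, Fin.castSucc_eq_zero_iff, Fin.castSucc_zero, Fin.castSucc_one,
    Fin.reduceCastSucc, Fin.reduceSucc, Fin.succ_one_eq_two, Fin.reduceEq, Fin.reduceLT,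
    lt_self_iff_false, one_ne_zero, ↓reduceIte, Fin.isValue]
  ring

end Warp

section WarpMetric

/-- The affine normal `-ε ψ` of a proper affine sphere `ψ` of mean curvature `ε` centred at the
origin. -/
abbrev sphereNormal {N : Type*} (ε : ℝ) (ψ : N → Fin 3 → ℝ) : N → Fin 3 → ℝ :=
  fun q => -(ε • ψ q)

variable {V : Type*} [NormedAddCommGroup V] [NormedSpace ℝ V]
  {γ₁ γ₂ : ℝ → ℝ} {ψ : V → Fin 3 → ℝ} {ε t : ℝ} {u : V} {ξ : ℝ × V → Fin 4 → ℝ}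

/-- The curve `γ` is smooth at `t`, and `ψ` is smooth at `u` with affine normal `-ε ψ`: the data
from which `warp γ₁ γ₂ ψ` is built near `(t, u)`. -/
structure IsSphereWarpAt (γ₁ γ₂ : ℝ → ℝ) (ψ : V → Fin 3 → ℝ) (ε t : ℝ) (u : V) : Prop where
  smooth₁ : ContDiffAt ℝ ∞ γ₁ t
  smooth₂ : ContDiffAt ℝ ∞ γ₂ t
  smooth : ContDiffAt ℝ ∞ ψ u
  sign : ε = 1 ∨ ε = -1
  blaschke : IsBlaschkeNormalAt ψ (sphereNormal ε ψ) u

/-- The Wronskian `γ₁' γ₂'' - γ₁'' γ₂'` of the velocity of the curve `γ`. -/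
noncomputable def wronskian (γ₁ γ₂ : ℝ → ℝ) (t : ℝ) : ℝ :=
  deriv γ₁ t * deriv (deriv γ₂) t - deriv (deriv γ₁) t * deriv γ₂ t

/-- The transversal component of the vector `(0, ψ)` with respect to `ξ`, to which the affine
metric of the warped surface is proportional. -/
noncomputable def radial (γ₁ γ₂ : ℝ → ℝ) (ψ : V → Fin 3 → ℝ) (ξ : ℝ × V → Fin 4 → ℝ)
    (z : ℝ × V) : ℝ :=
  (split (warp γ₁ γ₂ ψ) ξ z (consZero (ψ z.2))).2

namespace IsSphereWarpAt

theorem sq_eq_one (H : IsSphereWarpAt γ₁ γ₂ ψ ε t u) : ε ^ 2 = 1 :=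
  sq_eq_one_iff.2 H.sign

theorem contDiffAt_warp (H : IsSphereWarpAt γ₁ γ₂ ψ ε t u) :
    ContDiffAt ℝ ∞ (warp γ₁ γ₂ ψ) (t, u) :=
  AffineGeom.contDiffAt_warp H.smooth₁ H.smooth₂ H.smooth

theorem finrank_eq_two (H : IsSphereWarpAt γ₁ γ₂ ψ ε t u) : Module.finrank ℝ V = 2 :=
  finrank_eq_of_bijective_frame H.blaschke.transversal

theorem nontrivial (H : IsSphereWarpAt γ₁ γ₂ ψ ε t u) : Nontrivial V :=
  Module.nontrivial_of_finrank_pos (R := ℝ) (by rw [H.finrank_eq_two]; norm_num)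

theorem fderiv_apply (H : IsSphereWarpAt γ₁ γ₂ ψ ε t u) (s : ℝ) (X : V) :
    fderiv ℝ (warp γ₁ γ₂ ψ) (t, u) (s, X) = (deriv γ₁ t * s) • axis +
      consZero ((deriv γ₂ t * s) • ψ u + γ₂ t • fderiv ℝ ψ u X) :=
  fderiv_warp_apply (H.smooth₁.differentiableAt (by simp)) (H.smooth₂.differentiableAt (by simp))
    (H.smooth.differentiableAt (by simp)) s X

theorem fderiv_fderiv_surface (H : IsSphereWarpAt γ₁ γ₂ ψ ε t u) (X Y : V) :
    fderiv ℝ (fderiv ℝ (warp γ₁ γ₂ ψ)) (t, u) (0, X) (0, Y) =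
      fderiv ℝ (warp γ₁ γ₂ ψ) (t, u) (0, inducedConnection ψ (sphereNormal ε ψ) u X Y) +
        (-(ε * γ₂ t * metric ψ (sphereNormal ε ψ) u X Y)) • consZero (ψ u) := by
  rw [fderiv_fderiv_warp_apply H.smooth₁ H.smooth₂ H.smooth, H.fderiv_apply,
    gauss H.blaschke.transversal]
  simp only [mul_zero, zero_smul, zero_add, map_add, map_smul, map_neg]
  module

theorem fderiv_fderiv_mixed (H : IsSphereWarpAt γ₁ γ₂ ψ ε t u) (h₂ : γ₂ t ≠ 0) (X : V) :
    fderiv ℝ (fderiv ℝ (warp γ₁ γ₂ ψ)) (t, u) (1, 0) (0, X) =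
      fderiv ℝ (warp γ₁ γ₂ ψ) (t, u) (0, (deriv γ₂ t / γ₂ t) • X) := by
  rw [fderiv_fderiv_warp_apply H.smooth₁ H.smooth₂ H.smooth, H.fderiv_apply]
  simp [smul_smul, mul_div_cancel₀ _ h₂]

theorem smul_fderiv_fderiv_curve (H : IsSphereWarpAt γ₁ γ₂ ψ ε t u) :
    deriv γ₁ t • fderiv ℝ (fderiv ℝ (warp γ₁ γ₂ ψ)) (t, u) (1, 0) (1, 0) =
      fderiv ℝ (warp γ₁ γ₂ ψ) (t, u) (deriv (deriv γ₁) t, 0) +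
        wronskian γ₁ γ₂ t • consZero (ψ u) := by
  rw [fderiv_fderiv_warp_apply H.smooth₁ H.smooth₂ H.smooth, H.fderiv_apply, wronskian]
  simp only [map_zero, smul_zero, add_zero, mul_one, map_smul]
  module

theorem det_frameMatrix_position (H : IsSphereWarpAt γ₁ γ₂ ψ ε t u)
    (e : Module.Basis (Fin 2) ℝ V) : (frameMatrix ψ (fun _ => ψ u) e u).det =
      -ε * (frameMatrix ψ (sphereNormal ε ψ) e u).det := by
  have hψ : ψ u = fderiv ℝ ψ u 0 + (-ε) • sphereNormal ε ψ u := by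
    rw [map_zero, zero_add, sphereNormal, smul_neg, smul_smul, ← neg_smul, neg_mul, neg_neg,
      ← sq, H.sq_eq_one, one_smul]
  rw [← split_snd_mul_det_frameMatrix H.blaschke.transversal, hψ,
    split_add_smul H.blaschke.transversal]

section Transversal

variable (H : IsSphereWarpAt γ₁ γ₂ ψ ε t u)
  (hξ : Function.Bijective (frame (warp γ₁ γ₂ ψ) ξ (t, u)))
include H hξ

theorem ne_zero₂ : γ₂ t ≠ 0 := fun h => by
  have := H.nontrivial
  obtain ⟨X, hX⟩ := exists_ne (0 : V)
  have hker := split_fderiv hξ (0, X)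
  rw [H.fderiv_apply, h] at hker
  exact hX (by simpa using hker.symm)

theorem metric_surface (X Y : V) :
    metric (warp γ₁ γ₂ ψ) ξ (t, u) (0, X) (0, Y) =
      -(ε * γ₂ t * radial γ₁ γ₂ ψ ξ (t, u)) * metric ψ (sphereNormal ε ψ) u X Y := by
  rw [metric_apply, H.fderiv_fderiv_surface, map_add, map_smul, split_fderiv hξ, radial]
  simp only [Prod.snd_add, Prod.smul_snd, zero_add, smul_eq_mul]
  ring

theorem deriv_mul_metric_curve :
    deriv γ₁ t * metric (warp γ₁ γ₂ ψ) ξ (t, u) (1, 0) (1, 0) =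
      wronskian γ₁ γ₂ t * radial γ₁ γ₂ ψ ξ (t, u) := by
  rw [metric_apply, ← smul_eq_mul, ← Prod.smul_snd, ← map_smul, H.smul_fderiv_fderiv_curve,
    map_add, map_smul, split_fderiv hξ, radial]
  simp

theorem metric_curve_surface (Y : V) : metric (warp γ₁ γ₂ ψ) ξ (t, u) (1, 0) (0, Y) = 0 := by
  rw [metric_apply, H.fderiv_fderiv_mixed (H.ne_zero₂ hξ), split_fderiv hξ]

theorem isWarpedForm_metric :
    IsWarpedForm (metric (warp γ₁ γ₂ ψ) ξ (t, u)) (metric (warp γ₁ γ₂ ψ) ξ (t, u) (1, 0) (1, 0))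
      (-(ε * γ₂ t * radial γ₁ γ₂ ψ ξ (t, u))) (metric ψ (sphereNormal ε ψ) u) := by
  intro s s' X X'
  have hsplit : ∀ (s : ℝ) (X : V), (s, X) = s • ((1, 0) : ℝ × V) + (0, X) := fun s X => by simp
  rw [hsplit s X, hsplit s' X', map_add, map_add, map_smul, map_smul, add_apply, smul_apply,
    add_apply, smul_apply, metric_symm H.contDiffAt_warp (0, X) (1, 0), H.metric_curve_surface hξ,
    H.metric_curve_surface hξ, H.metric_surface hξ]
  simp only [smul_eq_mul]
  ring

theorem inducedConnection_mixed (X : V) :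
    inducedConnection (warp γ₁ γ₂ ψ) ξ (t, u) (1, 0) (0, X) = (0, (deriv γ₂ t / γ₂ t) • X) := by
  rw [inducedConnection, H.fderiv_fderiv_mixed (H.ne_zero₂ hξ), split_fderiv hξ]

theorem radial_mul_det (e : Module.Basis (Fin 2) ℝ V) :
    radial γ₁ γ₂ ψ ξ (t, u) * (frameMatrix (warp γ₁ γ₂ ψ) ξ (warpBasis e) (t, u)).det =
      -ε * (deriv γ₁ t * γ₂ t ^ 2) * (frameMatrix ψ (sphereNormal ε ψ) e u).det := by
  have hwarp := det_frameMatrix_warp (H.smooth₁.differentiableAt (by simp))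
    (H.smooth₂.differentiableAt (by simp)) (H.smooth.differentiableAt (by simp)) e 0 1
  rw [zero_smul, zero_add, one_smul] at hwarp
  rw [radial, split_snd_mul_det_frameMatrix hξ, hwarp, H.det_frameMatrix_position]
  ring

theorem sq_det_eq_abs_det_gram_iff (e : Module.Basis (Fin 2) ℝ V)
    (hrad : radial γ₁ γ₂ ψ ξ (t, u) ≠ 0) :
    (frameMatrix (warp γ₁ γ₂ ψ) ξ (warpBasis e) (t, u)).det ^ 2 =
        |(gramMatrix (metric (warp γ₁ γ₂ ψ) ξ (t, u)) (warpBasis e)).det| ↔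
      deriv γ₁ t ^ 2 * γ₂ t ^ 2 =
        |metric (warp γ₁ γ₂ ψ) ξ (t, u) (1, 0) (1, 0)| * radial γ₁ γ₂ ψ ξ (t, u) ^ 4 := by
  have hdet := H.radial_mul_det hξ e
  have hd := H.blaschke.sq_det_frameMatrix e
  have hd₀ := det_frameMatrix_ne_zero H.blaschke.transversal e
  have h₂ := H.ne_zero₂ hξ
  rw [(H.isWarpedForm_metric hξ).det_gramMatrix_warpBasis, abs_mul, abs_mul, ← hd, abs_pow, abs_neg,
    sq_abs, mul_pow, mul_pow, H.sq_eq_one, one_mul, ← mul_right_inj' (pow_ne_zero 2 hrad),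
    ← mul_pow, hdet, mul_pow, mul_pow, neg_sq, H.sq_eq_one, one_mul]
  refine Iff.trans (Eq.congr ?_ ?_)
    (mul_right_inj' (mul_ne_zero (pow_ne_zero 2 h₂) (pow_ne_zero 2 hd₀))) <;> ring

end Transversal

section Blaschke

variable (H : IsSphereWarpAt γ₁ γ₂ ψ ε t u) (hB : IsBlaschkeNormalAt (warp γ₁ γ₂ ψ) ξ (t, u))
include H hB

theorem radial_ne_zero : radial γ₁ γ₂ ψ ξ (t, u) ≠ 0 := fun h => by
  have := H.nontrivial
  exact (H.isWarpedForm_metric hB.transversal).ne_zero_right hB.nondegenerate (by simp [h])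

theorem metric_curve_ne_zero : metric (warp γ₁ γ₂ ψ) ξ (t, u) (1, 0) (1, 0) ≠ 0 :=
  (H.isWarpedForm_metric hB.transversal).ne_zero_left hB.nondegenerate

theorem abs_wronskian_mul_abs_radial_pow :
    |wronskian γ₁ γ₂ t| * |radial γ₁ γ₂ ψ ξ (t, u)| ^ 5 = |deriv γ₁ t| ^ 3 * γ₂ t ^ 2 := by
  have := finiteDimensional_of_injective_frame H.blaschke.transversal.1
  have hvolume := (H.sq_det_eq_abs_det_gram_iff hB.transversal
    (Module.finBasisOfFinrankEq ℝ V H.finrank_eq_two) (H.radial_ne_zero hB)).1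
      (hB.sq_det_frameMatrix _)
  have hcurve := congrArg abs (H.deriv_mul_metric_curve hB.transversal)
  rw [abs_mul, abs_mul] at hcurve
  rw [← sq_abs (deriv γ₁ t), ← (by decide : Even 4).pow_abs] at hvolume
  linear_combination -|radial γ₁ γ₂ ψ ξ (t, u)| ^ 4 * hcurve - |deriv γ₁ t| * hvolume

theorem deriv_ne_zero₁ : deriv γ₁ t ≠ 0 := fun h => by
  have := finiteDimensional_of_injective_frame H.blaschke.transversal.1
  let e := Module.finBasisOfFinrankEq ℝ V H.finrank_eq_two
  have hdet := H.radial_mul_det hB.transversal e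
  rw [h, zero_mul, mul_zero, zero_mul] at hdet
  exact mul_ne_zero (H.radial_ne_zero hB) (det_frameMatrix_ne_zero hB.transversal _) hdet

theorem metric_curve : metric (warp γ₁ γ₂ ψ) ξ (t, u) (1, 0) (1, 0) =
    wronskian γ₁ γ₂ t / deriv γ₁ t * radial γ₁ γ₂ ψ ξ (t, u) := by
  rw [div_mul_eq_mul_div, eq_div_iff (H.deriv_ne_zero₁ hB), mul_comm,
    H.deriv_mul_metric_curve hB.transversal]

theorem wronskian_ne_zero : wronskian γ₁ γ₂ t ≠ 0 := fun h =>
  H.metric_curve_ne_zero hB (by rw [H.metric_curve hB, h, zero_div, zero_mul])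

end Blaschke

end IsSphereWarpAt

end WarpMetric

section WarpCubicForm

variable {V : Type*} [NormedAddCommGroup V] [NormedSpace ℝ V]
  {γ₁ γ₂ : ℝ → ℝ} {ψ : V → Fin 3 → ℝ} {ε t : ℝ} {u : V} {ξ : ℝ × V → Fin 4 → ℝ}

theorem differentiableAt_radial (hψ : DifferentiableAt ℝ ψ u)
    (hB : IsBlaschkeNear (warp γ₁ γ₂ ψ) ξ (t, u)) :
    DifferentiableAt ℝ (radial γ₁ γ₂ ψ ξ) (t, u) := by
  have hψ' : DifferentiableAt ℝ (fun z : ℝ × V => consZero (ψ z.2)) (t, u) :=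
    consZero.differentiableAt.comp (t, u) (hψ.comp (t, u) differentiableAt_snd)
  have hsplit := contDiffAt_split hB.contDiffAt hB.contDiffAt_normal hB.bijective_frame
  exact ((hsplit.differentiableAt (by simp)).clm_apply hψ').snd

variable (H : ∀ᶠ z in 𝓝 (t, u), IsSphereWarpAt γ₁ γ₂ ψ ε z.1 z.2)
  (hB : IsBlaschkeNear (warp γ₁ γ₂ ψ) ξ (t, u))
include H hB

theorem fderiv_radial_surface (X : V) : fderiv ℝ (radial γ₁ γ₂ ψ ξ) (t, u) (0, X) = 0 := by
  have H₀ : IsSphereWarpAt γ₁ γ₂ ψ ε t u := H.self_of_nhds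
  have hW := H₀.wronskian_ne_zero hB.isBlaschkeNormalAt
  have hslice := (differentiableAt_radial (H₀.smooth.differentiableAt (by simp))
    hB).hasFDerivAt.comp u (hasFDerivAt_prodMk_right t u)
  have hconst : (fun v => radial γ₁ γ₂ ψ ξ (t, v) ^ 10) =ᶠ[𝓝 u]
      fun _ => (|deriv γ₁ t| ^ 3 * γ₂ t ^ 2 / |wronskian γ₁ γ₂ t|) ^ 2 := by
    filter_upwards [(Continuous.prodMk_right t).tendsto u |>.eventually (H.and hB)] with v hv
    rw [← hv.1.abs_wronskian_mul_abs_radial_pow hv.2.2.2, mul_div_cancel_left₀ _ (abs_ne_zero.2 hW),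
      ← pow_mul, (by decide : Even (5 * 2)).pow_abs]
  have hpow := (hslice.pow 10).unique ((hasFDerivAt_const _ u).congr_of_eventuallyEq hconst)
  simpa [H₀.radial_ne_zero hB.isBlaschkeNormalAt] using congrArg (· X) hpow

theorem metric_differenceTensor_surface_curve_curve (X : V) :
    metric (warp γ₁ γ₂ ψ) ξ (t, u)
      (differenceTensor (warp γ₁ γ₂ ψ) ξ (t, u) (0, X) (1, 0)) (1, 0) = 0 := by
  have H₀ : IsSphereWarpAt γ₁ γ₂ ψ ε t u := H.self_of_nhds
  have hradial := (differentiableAt_radial (H₀.smooth.differentiableAt (by simp))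
    hB).hasFDerivAt.comp u (hasFDerivAt_prodMk_right t u)
  have hmetric := (hB.hasFDerivAt_metric_apply (1, 0) (1, 0)).comp u (hasFDerivAt_prodMk_right t u)
  have hslice : (fun v => metric (warp γ₁ γ₂ ψ) ξ (t, v) (1, 0) (1, 0)) =ᶠ[𝓝 u]
      fun v => wronskian γ₁ γ₂ t / deriv γ₁ t * radial γ₁ γ₂ ψ ξ (t, v) := by
    filter_upwards [(Continuous.prodMk_right t).tendsto u |>.eventually (H.and hB)] with v hv
    exact hv.1.metric_curve hv.2.2.2
  have hderiv : fderiv ℝ (metric (warp γ₁ γ₂ ψ) ξ) (t, u) (0, X) (1, 0) (1, 0) = 0 := by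
    have := hmetric.unique ((hradial.const_mul _).congr_of_eventuallyEq hslice)
    simpa [fderiv_radial_surface H hB] using congrArg (· X) this
  rw [hB.metric_differenceTensor, hderiv, inducedConnection_symm hB.contDiffAt,
    H₀.inducedConnection_mixed hB.bijective_frame, metric_symm hB.contDiffAt (0, _),
    H₀.metric_curve_surface hB.bijective_frame]
  simp

theorem exists_metric_differenceTensor_curve_surface_surface :
    ∃ κ : ℝ, ∀ X Y : V, metric (warp γ₁ γ₂ ψ) ξ (t, u)
      (differenceTensor (warp γ₁ γ₂ ψ) ξ (t, u) (1, 0) (0, X)) (0, Y) =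
        κ * metric (warp γ₁ γ₂ ψ) ξ (t, u) (0, X) (0, Y) := by
  have H₀ : IsSphereWarpAt γ₁ γ₂ ψ ε t u := H.self_of_nhds
  let r : ℝ → ℝ := fun s => -(ε * γ₂ s * radial γ₁ γ₂ ψ ξ (s, u))
  have hr₀ : r t ≠ 0 := by
    have := H₀.nontrivial
    exact (H₀.isWarpedForm_metric hB.bijective_frame).ne_zero_right
      hB.isBlaschkeNormalAt.nondegenerate
  have hr : HasDerivAt r (deriv r t) t := by
    have hradial := (differentiableAt_radial (H₀.smooth.differentiableAt (by simp))
      hB).hasFDerivAt.comp_hasDerivAt t ((hasDerivAt_id t).prodMk (hasDerivAt_const t u))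
    exact (((H₀.smooth₂.differentiableAt (by simp)).const_mul ε).mul
      hradial.differentiableAt).neg.hasDerivAt
  refine ⟨-(1 / 2) * (deriv r t / r t - 2 * (deriv γ₂ t / γ₂ t)), fun X Y => ?_⟩
  have hmetric := (hB.hasFDerivAt_metric_apply (0, X) (0, Y)).comp_hasDerivAt t
    ((hasDerivAt_id t).prodMk (hasDerivAt_const t u))
  have hslice : (fun s => metric (warp γ₁ γ₂ ψ) ξ (s, u) (0, X) (0, Y)) =ᶠ[𝓝 t]
      fun s => r s * metric ψ (sphereNormal ε ψ) u X Y := by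
    filter_upwards [(Continuous.prodMk_left u).tendsto t |>.eventually (H.and hB)] with s hs
    exact hs.1.metric_surface hs.2.2.2.transversal X Y
  have hderiv : fderiv ℝ (metric (warp γ₁ γ₂ ψ) ξ) (t, u) (1, 0) (0, X) (0, Y) =
      deriv r t * metric ψ (sphereNormal ε ψ) u X Y :=
    hmetric.unique ((hr.mul_const _).congr_of_eventuallyEq hslice)
  have hsurface : ∀ X Y : V, metric (warp γ₁ γ₂ ψ) ξ (t, u) (0, X) (0, Y) =
    r t * metric ψ (sphereNormal ε ψ) u X Y := H₀.metric_surface hB.bijective_frame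
  rw [hB.metric_differenceTensor, hderiv, H₀.inducedConnection_mixed hB.bijective_frame,
    H₀.inducedConnection_mixed hB.bijective_frame, hsurface, hsurface, hsurface]
  simp only [map_smul, smul_apply, smul_eq_mul]
  field_simp
  ring

theorem exists_isNormalForm
    (hpos : ∀ X, X ≠ 0 → 0 < metric ψ (sphereNormal ε ψ) u X X)
    (hlorentz : ∃ b : Module.Basis (Fin 3) ℝ (ℝ × V),
      IsLorentzONB (metric (warp γ₁ γ₂ ψ) ξ (t, u)) b) :
    ∃ (b : Module.Basis (Fin 3) ℝ (ℝ × V)) (l r q : ℝ),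
      IsLorentzONB (metric (warp γ₁ γ₂ ψ) ξ (t, u)) b ∧
      IsNormalForm (differenceBilin (warp γ₁ γ₂ ψ) ξ (t, u)).toLinearMap₁₂ b l r q := by
  have H₀ : IsSphereWarpAt γ₁ γ₂ ψ ε t u := H.self_of_nhds
  have hform := H₀.isWarpedForm_metric hB.bijective_frame
  obtain ⟨b', hb'⟩ := hlorentz
  obtain ⟨ha, hr⟩ := hform.neg_and_pos (by rw [H₀.finrank_eq_two]; norm_num) hpos hb'
  obtain ⟨b, hb, hb₀, hbi⟩ := hform.exists_isLorentzONB H₀.finrank_eq_two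
    (metric_symm H₀.smooth) hpos ha hr
  obtain ⟨c, htime⟩ : ∃ c : ℝ, b 0 = c • (1, 0) := ⟨(b 0).1, Prod.ext (by simp) (by simp [hb₀])⟩
  have hspace : ∀ i, i ≠ 0 → b i = (0, (b i).2) := fun i hi => Prod.ext (hbi i hi) rfl
  obtain ⟨κ, hκ⟩ := exists_metric_differenceTensor_curve_surface_surface H hB
  have hsymm := hB.metric_differenceTensor_symm
  have hsymm' := hB.metric_differenceTensor_symm_right
  simp only [← differenceBilin_apply] at hκ hsymm hsymm'
  refine ⟨b, _, _, _, hb, hb.isNormalForm (κ := c * κ) hsymm hsymm' (fun i hi => ?_)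
    (fun i j hi hj => ?_) (hB.apolarity b)⟩
  · have hC := metric_differenceTensor_surface_curve_curve H hB (b i).2
    rw [← differenceBilin_apply, ← hspace i hi] at hC
    change metric _ _ _ (differenceBilin _ _ _ _ _) _ = 0
    rw [hsymm', hsymm, htime]
    simp only [map_smul, smul_apply, hC, smul_zero]
  · change metric _ _ _ (differenceBilin _ _ _ _ _) _ = _
    rw [htime, hspace i hi, hspace j hj]
    simp only [map_smul, smul_apply, hκ, smul_eq_mul, mul_assoc]

end WarpCubicForm

section WarpNormal

/-- The vector field `k e₀ - c f` along the warped hypersurface `f`, where `e₀` spans the axis: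
the candidate for its affine normal when the affine mean curvature is `c`. -/
def warpNormal {N : Type*} (k c : ℝ) (γ₁ γ₂ : ℝ → ℝ) (φ : N → Fin 3 → ℝ) : ℝ × N → Fin 4 → ℝ :=
  fun x => k • axis - c • warp γ₁ γ₂ φ x

/-- The determinant of the velocity of the curve `γ` and the profile `(k - c γ₁, -c γ₂)` of
`warpNormal k c γ₁ γ₂ φ`. -/
noncomputable def normalDet (k c : ℝ) (γ₁ γ₂ : ℝ → ℝ) (t : ℝ) : ℝ :=
  c * (γ₁ t * deriv γ₂ t - deriv γ₁ t * γ₂ t) - k * deriv γ₂ t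

/-- The curve `γ` solves at `t` the differential equation that makes `warpNormal k c γ₁ γ₂ φ` the
affine normal of the warped hypersurface, and `(k, c)` has the sign for which the affine metric is
a Lorentz metric. -/
structure SolvesWarpEquation (k c ε : ℝ) (γ₁ γ₂ : ℝ → ℝ) (t : ℝ) : Prop where
  equation : γ₂ t ^ 2 * |normalDet k c γ₁ γ₂ t| ^ 5 =
    Real.sign (deriv γ₁ t * γ₂ t * ε) * wronskian γ₁ γ₂ t * deriv γ₁ t ^ 2
  orientation : normalDet k c γ₁ γ₂ t * (deriv γ₁ t * γ₂ t * ε) < 0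

namespace SolvesWarpEquation

variable {k c ε t : ℝ} {γ₁ γ₂ : ℝ → ℝ} (h : SolvesWarpEquation k c ε γ₁ γ₂ t)
include h

theorem normalDet_ne_zero : normalDet k c γ₁ γ₂ t ≠ 0 :=
  left_ne_zero_of_mul h.orientation.ne

theorem deriv_ne_zero₁ : deriv γ₁ t ≠ 0 :=
  left_ne_zero_of_mul (left_ne_zero_of_mul (right_ne_zero_of_mul h.orientation.ne))

theorem ne_zero₂ : γ₂ t ≠ 0 :=
  right_ne_zero_of_mul (left_ne_zero_of_mul (right_ne_zero_of_mul h.orientation.ne))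

theorem sign_mul_wronskian_pos :
    0 < Real.sign (deriv γ₁ t * γ₂ t * ε) * wronskian γ₁ γ₂ t := by
  have hleft : 0 < γ₂ t ^ 2 * |normalDet k c γ₁ γ₂ t| ^ 5 :=
    mul_pos (sq_pos_of_ne_zero h.ne_zero₂) (pow_pos (abs_pos.2 h.normalDet_ne_zero) 5)
  exact pos_of_mul_pos_left (h.equation ▸ hleft) (sq_nonneg _)

theorem volume : γ₂ t ^ 2 * |normalDet k c γ₁ γ₂ t| ^ 5 =
    |wronskian γ₁ γ₂ t| * deriv γ₁ t ^ 2 := by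
  have hm := right_ne_zero_of_mul h.orientation.ne
  have hsign : |Real.sign (deriv γ₁ t * γ₂ t * ε)| = 1 := by
    rcases Real.sign_apply_eq_of_ne_zero _ hm with hs | hs <;> simp [hs]
  rw [h.equation, ← abs_of_pos h.sign_mul_wronskian_pos, abs_mul, hsign, one_mul]

theorem wronskian_div_neg : wronskian γ₁ γ₂ t / normalDet k c γ₁ γ₂ t < 0 := by
  have hpos := h.sign_mul_wronskian_pos
  rcases (right_ne_zero_of_mul h.orientation.ne).lt_or_gt with hm | hm
  · rw [Real.sign_of_neg hm] at hpos
    exact div_neg_of_neg_of_pos (by linarith) (pos_of_mul_neg_left h.orientation hm.le)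
  · rw [Real.sign_of_pos hm] at hpos
    exact div_neg_of_pos_of_neg (by linarith) (neg_of_mul_neg_left h.orientation hm.le)

theorem deriv_mul_div_neg : deriv γ₁ t * γ₂ t * ε / normalDet k c γ₁ γ₂ t < 0 :=
  div_neg_iff.2 ((mul_neg_iff.1 h.orientation).symm.imp And.symm And.symm)

end SolvesWarpEquation

theorem warpNormal_apply {N : Type*} (k c : ℝ) (γ₁ γ₂ : ℝ → ℝ) (φ : N → Fin 3 → ℝ) (t : ℝ)
    (q : N) :
    warpNormal k c γ₁ γ₂ φ (t, q) = (k - c * γ₁ t) • axis + (-c * γ₂ t) • consZero (φ q) := by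
  rw [warpNormal, warp_eq]
  module

variable {V : Type*} [NormedAddCommGroup V] [NormedSpace ℝ V]
  {γ₁ γ₂ : ℝ → ℝ} {ψ : V → Fin 3 → ℝ} {k c ε t : ℝ} {u : V}

namespace IsSphereWarpAt

variable (H : IsSphereWarpAt γ₁ γ₂ ψ ε t u)
include H

theorem fderiv_warpNormal (X : ℝ × V) :
    fderiv ℝ (warpNormal k c γ₁ γ₂ ψ) (t, u) X = (-c) • fderiv ℝ (warp γ₁ γ₂ ψ) (t, u) X := by
  have hwarp := (H.contDiffAt_warp.differentiableAt (by simp)).hasFDerivAt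
  have hnormal : HasFDerivAt (warpNormal k c γ₁ γ₂ ψ) (-(c • fderiv ℝ (warp γ₁ γ₂ ψ) (t, u)))
      (t, u) := (hwarp.const_smul c).const_sub (k • axis)
  simp [hnormal.fderiv]

theorem bijective_frame_warpNormal (h₂ : γ₂ t ≠ 0) (hD : normalDet k c γ₁ γ₂ t ≠ 0) :
    Function.Bijective (frame (warp γ₁ γ₂ ψ) (warpNormal k c γ₁ γ₂ ψ) (t, u)) := by
  have := finiteDimensional_of_injective_frame H.blaschke.transversal.1
  let e := Module.finBasisOfFinrankEq ℝ V H.finrank_eq_two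
  refine bijective_frame_of_det_frameMatrix_ne_zero (warpBasis e) ?_
  have hdet := det_frameMatrix_warp (H.smooth₁.differentiableAt (by simp))
    (H.smooth₂.differentiableAt (by simp)) (H.smooth.differentiableAt (by simp)) e
    (k - c * γ₁ t) (-c * γ₂ t)
  rw [← warpNormal_apply, H.det_frameMatrix_position] at hdet
  have hε : ε ≠ 0 := by rcases H.sign with h | h <;> simp [h]
  have hcurve : deriv γ₁ t * (-c * γ₂ t) - (k - c * γ₁ t) * deriv γ₂ t =
      normalDet k c γ₁ γ₂ t := by
    rw [normalDet]
    ring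
  rw [hcurve] at hdet
  exact hdet.trans_ne (mul_ne_zero (mul_ne_zero hD (pow_ne_zero 2 h₂))
    (mul_ne_zero (neg_ne_zero.2 hε) (det_frameMatrix_ne_zero H.blaschke.transversal e)))

theorem radial_warpNormal (h₂ : γ₂ t ≠ 0) (hD : normalDet k c γ₁ γ₂ t ≠ 0) :
    radial γ₁ γ₂ ψ (warpNormal k c γ₁ γ₂ ψ) (t, u) = deriv γ₁ t / normalDet k c γ₁ γ₂ t := by
  have hframe : normalDet k c γ₁ γ₂ t • consZero (ψ u) =
      fderiv ℝ (warp γ₁ γ₂ ψ) (t, u) (-(k - c * γ₁ t), 0) +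
        deriv γ₁ t • warpNormal k c γ₁ γ₂ ψ (t, u) := by
    rw [H.fderiv_apply, warpNormal_apply, normalDet]
    simp only [map_zero, smul_zero, add_zero, map_smul]
    module
  have hsplit := congrArg
    (fun v => (split (warp γ₁ γ₂ ψ) (warpNormal k c γ₁ γ₂ ψ) (t, u) v).2) hframe
  rw [split_add_smul (H.bijective_frame_warpNormal h₂ hD), map_smul, Prod.smul_snd] at hsplit
  rw [eq_div_iff hD, mul_comm]
  exact hsplit

variable (h : SolvesWarpEquation k c ε γ₁ γ₂ t)
include h

theorem isWarpedForm_metric_warpNormal :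
    IsWarpedForm (metric (warp γ₁ γ₂ ψ) (warpNormal k c γ₁ γ₂ ψ) (t, u))
      (wronskian γ₁ γ₂ t / normalDet k c γ₁ γ₂ t)
      (-(deriv γ₁ t * γ₂ t * ε / normalDet k c γ₁ γ₂ t)) (metric ψ (sphereNormal ε ψ) u) := by
  have hframe := H.bijective_frame_warpNormal h.ne_zero₂ h.normalDet_ne_zero
  have hrad := H.radial_warpNormal h.ne_zero₂ h.normalDet_ne_zero
  have hcurve := H.deriv_mul_metric_curve hframe
  rw [hrad, mul_div_left_comm] at hcurve
  convert H.isWarpedForm_metric hframe using 1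
  · exact (mul_left_cancel₀ h.deriv_ne_zero₁ hcurve).symm
  · rw [hrad]
    ring

theorem exists_isLorentzONB_warpNormal
    (hpos : ∀ X, X ≠ 0 → 0 < metric ψ (sphereNormal ε ψ) u X X) :
    ∃ b : Module.Basis (Fin 3) ℝ (ℝ × V),
      IsLorentzONB (metric (warp γ₁ γ₂ ψ) (warpNormal k c γ₁ γ₂ ψ) (t, u)) b :=
  ((H.isWarpedForm_metric_warpNormal h).exists_isLorentzONB H.finrank_eq_two
    (metric_symm H.smooth) hpos h.wronskian_div_neg (neg_pos.2 h.deriv_mul_div_neg)).imp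
      fun _ hb => hb.1

theorem isBlaschkeNormalAt_warpNormal :
    IsBlaschkeNormalAt (warp γ₁ γ₂ ψ) (warpNormal k c γ₁ γ₂ ψ) (t, u) := by
  have := finiteDimensional_of_injective_frame H.blaschke.transversal.1
  let e := Module.finBasisOfFinrankEq ℝ V H.finrank_eq_two
  have hframe := H.bijective_frame_warpNormal h.ne_zero₂ h.normalDet_ne_zero
  have hrad := H.radial_warpNormal h.ne_zero₂ h.normalDet_ne_zero
  have hform := H.isWarpedForm_metric_warpNormal h
  refine ⟨hframe, hform.nondegenerate h.wronskian_div_neg.ne (neg_ne_zero.2 h.deriv_mul_div_neg.ne)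
    H.blaschke.nondegenerate, fun X => transversalForm_eq_zero hframe (H.fderiv_warpNormal X),
    abs_det_frameMatrix_eq_sqrt_of_basis (warpBasis e) ?_⟩
  rw [H.sq_det_eq_abs_det_gram_iff hframe e
    (hrad.trans_ne (div_ne_zero h.deriv_ne_zero₁ h.normalDet_ne_zero)), hrad]
  have hcurve : metric (warp γ₁ γ₂ ψ) (warpNormal k c γ₁ γ₂ ψ) (t, u) (1, 0) (1, 0) =
    wronskian γ₁ γ₂ t / normalDet k c γ₁ γ₂ t := by simpa using hform 1 1 0 0
  have hD := abs_ne_zero.2 h.normalDet_ne_zero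
  rw [hcurve, abs_div, div_pow, ← (by decide : Even 4).pow_abs (normalDet k c γ₁ γ₂ t)]
  field_simp
  linear_combination deriv γ₁ t ^ 2 * h.volume

theorem shape_warpNormal (X : ℝ × V) :
    shape (warp γ₁ γ₂ ψ) (warpNormal k c γ₁ γ₂ ψ) (t, u) X = c • X :=
  shape_eq_smul (H.bijective_frame_warpNormal h.ne_zero₂ h.normalDet_ne_zero)
    (H.fderiv_warpNormal X)

end IsSphereWarpAt

end WarpNormal

section Charts

variable {E : Type*} [NormedAddCommGroup E] [NormedSpace ℝ E] {H : Type*} [TopologicalSpace H]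
  {I : ModelWithCorners ℝ E H} [I.Boundaryless] {M : Type*} [TopologicalSpace M] [ChartedSpace H M]
  {n : ℕ} {U : Set M} {p : M} {y : E}

theorem eventually_mem_chart (hU : IsOpen U) (hy : y ∈ (extChartAt I p).target)
    (hyU : (extChartAt I p).symm y ∈ U) :
    ∀ᶠ z in 𝓝 y, z ∈ (extChartAt I p).target ∧ (extChartAt I p).symm z ∈ U :=
  ((isOpen_extChartAt_target p).eventually_mem hy).and
    ((continuousAt_extChartAt_symm'' hy).eventually (hU.mem_nhds hyU))

variable [IsManifold I ∞ M]

theorem contDiffAt_inChart (hU : IsOpen U) {f : M → Fin (n + 1) → ℝ}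
    (hf : ContMDiffOn I 𝓘(ℝ, Fin (n + 1) → ℝ) ∞ f U) (hy : y ∈ (extChartAt I p).target)
    (hyU : (extChartAt I p).symm y ∈ U) : ContDiffAt ℝ ∞ (inChart I f p) y :=
  ((hf.contMDiffAt (hU.mem_nhds hyU)).comp y ((contMDiffOn_extChartAt_symm p).contMDiffAt
    ((isOpen_extChartAt_target p).mem_nhds hy))).contDiffAt

theorem IsBlaschkeImmersionOn.isBlaschkeNear {f ξ : M → Fin (n + 1) → ℝ} (hU : IsOpen U)
    (h : IsBlaschkeImmersionOn I f ξ U) (hy : y ∈ (extChartAt I p).target)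
    (hyU : (extChartAt I p).symm y ∈ U) :
    IsBlaschkeNear (inChart I f p) (inChart I ξ p) y := by
  filter_upwards [eventually_mem_chart hU hy hyU] with z hz
  exact ⟨contDiffAt_inChart hU h.smooth hz.1 hz.2, contDiffAt_inChart hU h.smooth_normal hz.1 hz.2,
    h.blaschke p z hz.1 hz.2⟩

end Charts

section WarpedAffineSphere

variable {N : Type*} [TopologicalSpace N] [ChartedSpace (EuclideanSpace ℝ (Fin 2)) N]
  {φ : N → Fin 3 → ℝ} {k c ε : ℝ} {J : Set ℝ} {γ₁ γ₂ : ℝ → ℝ}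

theorem extChartAt_modelProd (p : ℝ × N) :
    extChartAt modelProd p = (PartialEquiv.refl ℝ).prod (extChartAt (𝓡 2) p.2) := by
  rw [extChartAt_prod, extChartAt_model_space_eq_id]

theorem extChartAt_modelProd_self (p : ℝ × N) :
    extChartAt modelProd p p = (p.1, extChartAt (𝓡 2) p.2 p.2) := by
  rw [extChartAt_modelProd]
  rfl

theorem inChart_warp (γ₁ γ₂ : ℝ → ℝ) (φ : N → Fin 3 → ℝ) (p : ℝ × N) :
    inChart modelProd (warp γ₁ γ₂ φ) p = warp γ₁ γ₂ (inChart (𝓡 2) φ p.2) := by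
  rw [inChart, extChartAt_modelProd]
  rfl

theorem inChart_warpNormal (k c : ℝ) (γ₁ γ₂ : ℝ → ℝ) (φ : N → Fin 3 → ℝ) (p : ℝ × N) :
    inChart modelProd (warpNormal k c γ₁ γ₂ φ) p =
      warpNormal k c γ₁ γ₂ (inChart (𝓡 2) φ p.2) := by
  rw [inChart, extChartAt_modelProd]
  rfl

theorem contMDiffOn_warp (hφ : ContMDiff (𝓡 2) 𝓘(ℝ, Fin 3 → ℝ) ∞ φ)
    (hγ₁ : ContDiffOn ℝ ∞ γ₁ J) (hγ₂ : ContDiffOn ℝ ∞ γ₂ J) :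
    ContMDiffOn modelProd 𝓘(ℝ, Fin 4 → ℝ) ∞ (warp γ₁ γ₂ φ) (J ×ˢ Set.univ) := by
  have hcurve {γ : ℝ → ℝ} (hγ : ContDiffOn ℝ ∞ γ J) :
      ContMDiffOn modelProd 𝓘(ℝ, ℝ) ∞ (fun x : ℝ × N => γ x.1) (J ×ˢ Set.univ) :=
    hγ.contMDiffOn.comp contMDiff_fst.contMDiffOn fun x hx => hx.1
  have hsurface : ContMDiff modelProd 𝓘(ℝ, Fin 4 → ℝ) ∞ fun x : ℝ × N => consZero (φ x.2) :=
    consZero.contDiff.contMDiff.comp (hφ.comp contMDiff_snd)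
  rw [warp_eq]
  exact ((hcurve hγ₁).smul contMDiffOn_const).add ((hcurve hγ₂).smul hsurface.contMDiffOn)

theorem contMDiffOn_warpNormal (hφ : ContMDiff (𝓡 2) 𝓘(ℝ, Fin 3 → ℝ) ∞ φ)
    (hγ₁ : ContDiffOn ℝ ∞ γ₁ J) (hγ₂ : ContDiffOn ℝ ∞ γ₂ J) :
    ContMDiffOn modelProd 𝓘(ℝ, Fin 4 → ℝ) ∞ (warpNormal k c γ₁ γ₂ φ) (J ×ˢ Set.univ) :=
  have hc : ContMDiffOn modelProd 𝓘(ℝ, ℝ) ∞ (fun _ : ℝ × N => c) (J ×ˢ Set.univ) :=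
    contMDiffOn_const
  contMDiffOn_const.sub (hc.smul (contMDiffOn_warp hφ hγ₁ hγ₂))

variable [IsManifold (𝓡 2) ∞ N]

theorem isSphereWarpAt_inChart (hφ : IsDefiniteProperAffineSphere φ ε) (hJ : IsOpen J)
    (hγ₁ : ContDiffOn ℝ ∞ γ₁ J) (hγ₂ : ContDiffOn ℝ ∞ γ₂ J) {t : ℝ} (ht : t ∈ J) {p : N}
    {u : EuclideanSpace ℝ (Fin 2)} (hu : u ∈ (extChartAt (𝓡 2) p).target) :
    IsSphereWarpAt γ₁ γ₂ (inChart (𝓡 2) φ p) ε t u where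
  smooth₁ := hγ₁.contDiffAt (hJ.mem_nhds ht)
  smooth₂ := hγ₂.contDiffAt (hJ.mem_nhds ht)
  smooth := contDiffAt_inChart isOpen_univ hφ.2.1.smooth hu (Set.mem_univ _)
  sign := hφ.1
  blaschke := hφ.2.1.blaschke p u hu (Set.mem_univ _)

theorem exists_isNormalForm_warp (hφ : IsDefiniteProperAffineSphere φ ε) (hJ : IsOpen J)
    (hγ₁ : ContDiffOn ℝ ∞ γ₁ J) (hγ₂ : ContDiffOn ℝ ∞ γ₂ J) {ξ : ℝ × N → Fin 4 → ℝ}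
    (h : IsIndefiniteAffineHypersphereOn modelProd (warp γ₁ γ₂ φ) ξ c (J ×ˢ Set.univ))
    {p : ℝ × N} (hp : p ∈ J ×ˢ (Set.univ : Set N)) :
    ∃ (b : Module.Basis (Fin 3) ℝ (ℝ × EuclideanSpace ℝ (Fin 2))) (l r q : ℝ),
      IsLorentzONB (metricAt modelProd (warp γ₁ γ₂ φ) ξ p) b ∧
      IsNormalForm (differenceBilin (inChart modelProd (warp γ₁ γ₂ φ) p) (inChart modelProd ξ p)
        (extChartAt modelProd p p)).toLinearMap₁₂ b l r q := by
  have hB := h.isBlaschkeNear (hJ.prod isOpen_univ) (mem_extChartAt_target (I := modelProd) p)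
    (by rwa [extChartAt_to_inv])
  have hL := h.lorentz p hp
  rw [metricAt] at hL ⊢
  rw [inChart_warp, extChartAt_modelProd_self] at hB hL ⊢
  refine exists_isNormalForm ?_ hB (hφ.2.2 p.2) hL
  filter_upwards [continuousAt_fst.eventually (hJ.mem_nhds hp.1),
    continuousAt_snd.eventually ((isOpen_extChartAt_target (I := 𝓡 2) p.2).mem_nhds
      (mem_extChartAt_target p.2))] with z ht hu
  exact isSphereWarpAt_inChart hφ hJ hγ₁ hγ₂ ht hu

theorem exists_isLorentzONB_symmetriesAt_warp (hφ : IsDefiniteProperAffineSphere φ ε)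
    (hJ : IsOpen J) (hγ₁ : ContDiffOn ℝ ∞ γ₁ J) (hγ₂ : ContDiffOn ℝ ∞ γ₂ J)
    {ξ : ℝ × N → Fin 4 → ℝ}
    (h : IsIndefiniteAffineHypersphereOn modelProd (warp γ₁ γ₂ φ) ξ c (J ×ˢ Set.univ))
    {p : ℝ × N} (hp : p ∈ J ×ˢ (Set.univ : Set N)) :
    ∃ b : Module.Basis (Fin 3) ℝ (ℝ × EuclideanSpace ℝ (Fin 2)),
      IsLorentzONB (metricAt modelProd (warp γ₁ γ₂ φ) ξ p) b ∧
      (symmetriesAt modelProd (warp γ₁ γ₂ φ) ξ p b ∩ groupSO2 = groupZ3 ∨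
        symmetriesAt modelProd (warp γ₁ γ₂ φ) ξ p b ∩ groupSO2 = groupSO2) ∧
      (differenceTensorAt modelProd (warp γ₁ γ₂ φ) ξ p (b 0) (b 0) ≠ 0 →
        symmetriesAt modelProd (warp γ₁ γ₂ φ) ξ p b ⊆ groupSO2) := by
  obtain ⟨b, l, r, q, hb, hK⟩ := exists_isNormalForm_warp hφ hJ hγ₁ hγ₂ h hp
  have hS (X) : shapeAt modelProd (warp γ₁ γ₂ φ) ξ p X = c • X :=
    h.shape_eq p _ (mem_extChartAt_target p) (by rwa [extChartAt_to_inv]) X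
  exact ⟨b, hb, hK.tensorSymmetries_inter_groupSO2 hb hS, hK.tensorSymmetries_subset_groupSO2 hb⟩

theorem admitsPointwiseSymmetryOn_groupZ3_warp (hφ : IsDefiniteProperAffineSphere φ ε)
    (hJ : IsOpen J) (hγ₁ : ContDiffOn ℝ ∞ γ₁ J) (hγ₂ : ContDiffOn ℝ ∞ γ₂ J)
    {ξ : ℝ × N → Fin 4 → ℝ}
    (h : IsIndefiniteAffineHypersphereOn modelProd (warp γ₁ γ₂ φ) ξ c (J ×ˢ Set.univ)) :
    AdmitsPointwiseSymmetryOn modelProd (warp γ₁ γ₂ φ) ξ (J ×ˢ Set.univ) groupZ3 := fun p hp => by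
  obtain ⟨b, hb, hG | hG, -⟩ := exists_isLorentzONB_symmetriesAt_warp hφ hJ hγ₁ hγ₂ h hp
  · exact ⟨b, hb, hG ▸ Set.inter_subset_left⟩
  · exact ⟨b, hb, fun A hA => Set.inter_eq_right.1 hG (groupZ3_le_groupSO2 hA)⟩

theorem isIndefiniteAffineHypersphereOn_warp (hφ : IsDefiniteProperAffineSphere φ ε)
    (hJ : IsOpen J) (hγ₁ : ContDiffOn ℝ ∞ γ₁ J) (hγ₂ : ContDiffOn ℝ ∞ γ₂ J)
    (h : ∀ t ∈ J, SolvesWarpEquation k c ε γ₁ γ₂ t) :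
    IsIndefiniteAffineHypersphereOn modelProd (warp γ₁ γ₂ φ) (warpNormal k c γ₁ γ₂ φ) c
      (J ×ˢ (Set.univ : Set N)) := by
  have hsphere (p : ℝ × N) {y} (hy : y ∈ (extChartAt modelProd p).target)
      (hyJ : (extChartAt modelProd p).symm y ∈ J ×ˢ (Set.univ : Set N)) :
      y.1 ∈ J ∧ IsSphereWarpAt γ₁ γ₂ (inChart (𝓡 2) φ p.2) ε y.1 y.2 := by
    rw [extChartAt_modelProd] at hy hyJ
    exact ⟨hyJ.1, isSphereWarpAt_inChart hφ hJ hγ₁ hγ₂ hyJ.1 hy.2⟩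
  refine
    { smooth := contMDiffOn_warp (contMDiffOn_univ.1 hφ.2.1.smooth) hγ₁ hγ₂
      smooth_normal := contMDiffOn_warpNormal (contMDiffOn_univ.1 hφ.2.1.smooth) hγ₁ hγ₂
      blaschke := fun p y hy hyJ => ?_
      shape_eq := fun p y hy hyJ => ?_
      lorentz := fun p hp => ?_ }
  · rw [inChart_warp, inChart_warpNormal]
    obtain ⟨ht, H⟩ := hsphere p hy hyJ
    exact H.isBlaschkeNormalAt_warpNormal (h _ ht)
  · rw [inChart_warp, inChart_warpNormal]
    obtain ⟨ht, H⟩ := hsphere p hy hyJ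
    exact H.shape_warpNormal (h _ ht)
  · rw [metricAt, inChart_warp, inChart_warpNormal, extChartAt_modelProd_self]
    exact (isSphereWarpAt_inChart hφ hJ hγ₁ hγ₂ hp.1
      (mem_extChartAt_target p.2)).exists_isLorentzONB_warpNormal (h p.1 hp.1) (hφ.2.2 p.2)

end WarpedAffineSphere

section Orientation

theorem normalDet_mul (s k c : ℝ) (γ₁ γ₂ : ℝ → ℝ) (t : ℝ) :
    normalDet (s * k) (s * c) γ₁ γ₂ t = s * normalDet k c γ₁ γ₂ t := by
  rw [normalDet, normalDet]
  ring

theorem exists_sign_mul_neg {J : Set ℝ} (hJ : J.OrdConnected) {m : ℝ → ℝ}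
    (hm : ContinuousOn m J) (hm₀ : ∀ t ∈ J, m t ≠ 0) :
    ∃ s : ℝ, (s = 1 ∨ s = -1) ∧ ∀ t ∈ J, s * m t < 0 := by
  by_cases hneg : ∀ t ∈ J, m t < 0
  · exact ⟨1, Or.inl rfl, by simpa using hneg⟩
  · push Not at hneg
    obtain ⟨a, ha, hma⟩ := hneg
    refine ⟨-1, Or.inr rfl, fun b hb => ?_⟩
    rw [neg_one_mul, neg_lt_zero]
    by_contra! hmb
    obtain ⟨x, hx, hx₀⟩ := hJ.isPreconnected.intermediate_value hb ha hm ⟨hmb, hma⟩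
    exact hm₀ x hx hx₀

theorem exists_sign_solvesWarpEquation {J : Set ℝ} (hJ : IsOpen J) (hJ' : J.OrdConnected)
    {γ₁ γ₂ : ℝ → ℝ} (hγ₁ : ContDiffOn ℝ ∞ γ₁ J) (hγ₂ : ContDiffOn ℝ ∞ γ₂ J) {k c ε : ℝ}
    (hε : ε ≠ 0)
    (hode : ∀ t ∈ J, γ₂ t ^ 2 * |normalDet k c γ₁ γ₂ t| ^ 5 =
        Real.sign (deriv γ₁ t * γ₂ t * ε) * wronskian γ₁ γ₂ t * deriv γ₁ t ^ 2 ∧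
      γ₂ t ^ 2 * |normalDet k c γ₁ γ₂ t| ^ 5 ≠ 0) :
    ∃ s : ℝ, (s = 1 ∨ s = -1) ∧ ∀ t ∈ J, SolvesWarpEquation (s * k) (s * c) ε γ₁ γ₂ t := by
  have hγ₁' : ContinuousOn (deriv γ₁) J := (hγ₁.deriv_of_isOpen (m := 0) hJ (by simp)).continuousOn
  have hγ₂' : ContinuousOn (deriv γ₂) J := (hγ₂.deriv_of_isOpen (m := 0) hJ (by simp)).continuousOn
  have hcont : ContinuousOn (fun t => normalDet k c γ₁ γ₂ t * (deriv γ₁ t * γ₂ t * ε)) J := by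
    have := hγ₁.continuousOn
    have := hγ₂.continuousOn
    unfold normalDet
    fun_prop
  have hne (t) (ht : t ∈ J) : normalDet k c γ₁ γ₂ t * (deriv γ₁ t * γ₂ t * ε) ≠ 0 := by
    obtain ⟨heq, hne⟩ := hode t ht
    refine mul_ne_zero ?_ (mul_ne_zero (mul_ne_zero ?_ ?_) hε) <;> intro h₀
    · simp [h₀] at hne
    · simp [heq, h₀] at hne
    · simp [h₀] at hne
  obtain ⟨s, hs, hneg⟩ := exists_sign_mul_neg hJ' hcont hne
  have hs_abs : |s| = 1 := by rcases hs with rfl | rfl <;> simp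
  refine ⟨s, hs, fun t ht => ⟨?_, ?_⟩⟩
  · rw [normalDet_mul, abs_mul, hs_abs, one_mul, (hode t ht).1]
  · rw [normalDet_mul, mul_assoc]
    exact hneg t ht

end Orientation

end AffineGeom

theorem mainTheorem6
    {N : Type*} [TopologicalSpace N] [ChartedSpace (EuclideanSpace ℝ (Fin 2)) N]
    [IsManifold (𝓡 2) ∞ N] (φ : N → Fin 3 → ℝ) (ε : ℝ)
    (hφ : IsDefiniteProperAffineSphere φ ε)
    (J : Set ℝ) (hJ : IsOpen J) (hJ' : J.OrdConnected)
    (γ₁ γ₂ : ℝ → ℝ) (hγ₁ : ContDiffOn ℝ ∞ γ₁ J) (hγ₂ : ContDiffOn ℝ ∞ γ₂ J) :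
    (∀ (ξ : ℝ × N → Fin 4 → ℝ) (c : ℝ),
      IsIndefiniteAffineHypersphereOn modelProd (warp γ₁ γ₂ φ) ξ c (J ×ˢ Set.univ) →
        (AdmitsPointwiseSymmetryOn modelProd (warp γ₁ γ₂ φ) ξ (J ×ˢ Set.univ) groupZ3 ∨
          AdmitsPointwiseSymmetryOn modelProd (warp γ₁ γ₂ φ) ξ (J ×ˢ Set.univ) groupSO2) ∧
        ∀ p ∈ J ×ˢ (Set.univ : Set N),
          ∃ b : Module.Basis (Fin 3) ℝ (ℝ × EuclideanSpace ℝ (Fin 2)),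
            IsLorentzONB (metricAt modelProd (warp γ₁ γ₂ φ) ξ p) b ∧
            (symmetriesAt modelProd (warp γ₁ γ₂ φ) ξ p b ∩ groupSO2 = groupZ3 ∨
              symmetriesAt modelProd (warp γ₁ γ₂ φ) ξ p b ∩ groupSO2 = groupSO2) ∧
            (differenceTensorAt modelProd (warp γ₁ γ₂ φ) ξ p (b 0) (b 0) ≠ 0 →
              symmetriesAt modelProd (warp γ₁ γ₂ φ) ξ p b ⊆ groupSO2)) ∧
    ((∀ t ∈ J,
        γ₂ t ^ 2 * |γ₁ t * deriv γ₂ t - deriv γ₁ t * γ₂ t| ^ 5 =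
          Real.sign (deriv γ₁ t * γ₂ t * ε) *
            (deriv γ₁ t * deriv (deriv γ₂) t - deriv (deriv γ₁) t * deriv γ₂ t) *
            deriv γ₁ t ^ 2 ∧
        γ₂ t ^ 2 * |γ₁ t * deriv γ₂ t - deriv γ₁ t * γ₂ t| ^ 5 ≠ 0) →
      ∃ (ξ : ℝ × N → Fin 4 → ℝ) (c : ℝ), (c = 1 ∨ c = -1) ∧
        IsIndefiniteAffineHypersphereOn modelProd (warp γ₁ γ₂ φ) ξ c (J ×ˢ Set.univ)) ∧
    ((∀ t ∈ J,
        γ₂ t ^ 2 * |deriv γ₂ t| ^ 5 =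
          Real.sign (deriv γ₁ t * γ₂ t * ε) *
            (deriv γ₁ t * deriv (deriv γ₂) t - deriv (deriv γ₁) t * deriv γ₂ t) *
            deriv γ₁ t ^ 2 ∧
        γ₂ t ^ 2 * |deriv γ₂ t| ^ 5 ≠ 0) →
      ∃ ξ : ℝ × N → Fin 4 → ℝ,
        IsIndefiniteAffineHypersphereOn modelProd (warp γ₁ γ₂ φ) ξ 0 (J ×ˢ Set.univ)) := by
  have hε : ε ≠ 0 := by rcases hφ.1 with rfl | rfl <;> norm_num
  refine ⟨fun ξ c h => ⟨Or.inl (admitsPointwiseSymmetryOn_groupZ3_warp hφ hJ hγ₁ hγ₂ h),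
    fun p hp => exists_isLorentzONB_symmetriesAt_warp hφ hJ hγ₁ hγ₂ h hp⟩,
    fun hode => ?_, fun hode => ?_⟩
  · obtain ⟨s, hs, hsol⟩ := exists_sign_solvesWarpEquation (k := 0) (c := 1) hJ hJ' hγ₁ hγ₂ hε
      (by simpa [normalDet, wronskian] using hode)
    exact ⟨_, s * 1, by simpa using hs, isIndefiniteAffineHypersphereOn_warp hφ hJ hγ₁ hγ₂ hsol⟩
  · obtain ⟨s, -, hsol⟩ := exists_sign_solvesWarpEquation (k := -1) (c := 0) hJ hJ' hγ₁ hγ₂ hε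
      (by simpa [normalDet, wronskian] using hode)
    rw [mul_zero] at hsol
    exact ⟨_, isIndefiniteAffineHypersphereOn_warp hφ hJ hγ₁ hγ₂ hsol⟩
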